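/- **Setting (affinity bandits).** There are $K>1$ arms, with unknown means $\mu_1,\dots,\mu_K\in\mathbb R$. Write $\mu_{\max}=\max_j\mu_j$, $\Delta_i=\mu_{\max}-\mu_i$ and $\Delta_{\max}=\max_i\Delta_i$. Let $\mathcal E_{\mathcal N}$ be the class of Gaussian environments $\nu=(\mathcal N(\mu_i,1))_{i\in[K]}$ with $\Delta_i\in[0,1]$ for all $i$. A *bias model* consists of initial biases $T^0_i\ge 1$ ($i\in[K]$) and a non-decreasing Lipschitz function $f:(0,1]\to[0,1]$; put $f(x)=f(1)$ for $x>1$. A (randomized) policy chooses, in each round $t\ge1$, an arm $A_t\in[K]$ based on the past $(A_s,Y_s)_{s<t}$, and then observes feedback $Y_t$ which, given the past and $A_t=i$, has law $$\mathcal N\big(\mu_i\,W_i(t),1\big),\qquad W_i(t)=f\Big(\frac{T^0_i+T_i(t-1)}{\sum_{j}T^0_j+t-1}\Big),$$ where $T_i(t)$ is the number of times that arm $i$ is played in rounds $1,\dots,t$. The regret is $R_\nu(\pi,n)=\sum_i\Delta_i\,\mathbb E[T_i(n)]$. For $C>0$ and $a\in(0,1)$, a family of policies $(\pi_n)_{n\ge1}$,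 which may depend on the horizon $n$, on $f$ and on the $T^0_i$, is *consistent* with constants $(C,a)$ if $R_\nu(\pi_n,n)\le Cn^a$ for all $n\ge1$ and all $\nu\in\mathcal E_{\mathcal N}$ (with this fixed bias model). **Theorem.** There are absolute constants $C_0,C_1>0$ such that the following holds for every $K>1$, every bias model, every $\nu\in\mathcal E_{\mathcal N}$, all $C>0$, $a\in(0,1)$, $c,c'\ge 0$ and every $\varepsilon\in\big(0,\frac{1-\mu_{\max}}{\Delta_{\max}}\big]$ (in particular it is assumed that this interval is non-empty). For $\gamma\in(0,1)$ let $$\beta'(\gamma)=\frac{C_1}{\gamma}\Big(\log\frac K\gamma+c\,(\log K)^{c'}\Big).$$ 1. Let $\gamma\in(0,1)$ and let $\mathcal A\subseteq[K]$ be a set of suboptimal arms ($\Delta_i>0$ for $i\in\mathcal A$) with $|\mathcal A|\ge\gamma K$ and $\log(\Delta_i/\Delta_j)\le c(\log K)^{c'}$ for all $i,j\in\mathcal A$. Suppose that $f\big(\tfrac{2}{\gamma K}\big)>0$ and $-\log f\big(\tfrac{2}{\gamma K}\big)\le c(\log K)^{c'}$. Then, with $\beta'=\beta'(\gamma)$,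 we have $f(\beta'/K)>0$, and there is an $N$ such that for every $n\ge N$ and every family $(\pi_n)$ that is consistent with constants $(C,a)$ there is a set $B'\subseteq\mathcal A$ with $|B'|\ge|\mathcal A|/4$ and $$R_\nu(\pi_n,n)\ \ge\ C_0\bigg(f\Big(\frac{\beta'}{K}\Big)^{-2}\sum_{i\in B':\,\Delta_i>0}\frac{\gamma(1-a)\log n}{\Delta_i}+\sum_{i\notin B':\,\Delta_i>0}\frac{(1-a)\log n}{\Delta_i}\bigg).$$ 2. Suppose that $\nu$ has a unique optimal arm and that $\Delta_i/\Delta_j\le c$ for all suboptimal arms $i,j$. Put $\gamma=\frac{K-1}{K}$ and suppose that $f\big(\tfrac{2}{\gamma K}\big)>0$ and $-\log f\big(\tfrac2{\gamma K}\big)\le c(\log K)^{c'}$. Then, with $\beta'=\beta'\big(\tfrac{K-1}{K}\big)$, which is $O(\log K+c(\log K)^{c'})$, we have $f(\beta'/K)>0$, and there is an $N$ such that for every $n\ge N$ and every family $(\pi_n)$ that is consistent with constants $(C,a)$, $$R_\nu(\pi_n,n)\ \ge\ \frac{C_0(1-a)}{c}\,f\Big(\frac{\beta'}{K}\Big)^{-2}\sum_{i:\,\Delta_i>0}\frac{\log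 n}{\Delta_i}.$$ Here $N$ may depend on everything quantified before it, but not on the policies. -/

import Mathlib

open MeasureTheory ProbabilityTheory

noncomputable section

namespace AffinityBandit

/-- One round of interaction with `K` arms: the arm played and the feedback observed. -/
abbrev Round (K : ℕ) : Type := Fin K × ℝ

/-- The list of the first `t` rounds; entry `s : Fin t` is round `s + 1`. -/
abbrev History (K t : ℕ) : Type := Fin t → Round K

/-- `T_i(t)`: the number of times that arm `i` is played in the first `t` rounds. -/
def pulls {K t : ℕ} (i : Fin K) (h : History K t) : ℕ :=
  ∑ s : Fin t, if (h s).1 = i then 1 else 0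

/-- The bias model: initial biases `T⁰_i ≥ 1`, and a reweighting function
`f : (0,1] → [0,1]` that is non-decreasing and Lipschitz. The values of `f` outside `(0,1]`
are never used. -/
structure BiasModel (K : ℕ) where
  T0 : Fin K → ℝ
  one_le_T0 : ∀ i, 1 ≤ T0 i
  f : ℝ → ℝ
  f_mem : ∀ x ∈ Set.Ioc (0 : ℝ) 1, f x ∈ Set.Icc (0 : ℝ) 1
  f_mono : MonotoneOn f (Set.Ioc 0 1)
  f_lipschitz : ∃ L : NNReal, LipschitzOnWith L f (Set.Ioc 0 1)

/-- The reweighting function, continued by the constant `f 1` to arguments above `1`. -/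
def BiasModel.fbar {K : ℕ} (B : BiasModel K) (x : ℝ) : ℝ := B.f (min x 1)

/-- The fraction `(T⁰_i + T_i(t)) / (∑_j T⁰_j + t)` after `t` rounds. -/
def BiasModel.fraction {K : ℕ} (B : BiasModel K) {t : ℕ} (i : Fin K) (h : History K t) : ℝ :=
  (B.T0 i + pulls i h) / ((∑ j, B.T0 j) + t)

/-- The reweighting `W_i(t+1)` of arm `i` in round `t + 1`, given the first `t` rounds. -/
def BiasModel.weight {K : ℕ} (B : BiasModel K) {t : ℕ} (i : Fin K) (h : History K t) : ℝ :=
  B.f (B.fraction i h)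

/-- The suboptimality gap `Δ_i = max_j μ_j - μ_i`. -/
def gap {K : ℕ} (μ : Fin K → ℝ) (i : Fin K) : ℝ := (⨆ j, μ j) - μ i

/-- The class of Gaussian environments `(N(μ_i, 1))_i` whose gaps lie in `[0,1]`; an environment
is given by its vector of means. -/
def gaussianClass (K : ℕ) : Set (Fin K → ℝ) := {μ | ∀ i, gap μ i ∈ Set.Icc (0 : ℝ) 1}

/-- A (randomized, history-dependent) bandit policy: `act t h` is the law of the arm played in
round `t + 1` given the first `t` rounds `h`. -/
structure Policy (K : ℕ) where
  act : ∀ t : ℕ, Kernel (History K t) (Fin K)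
  markov : ∀ t, IsMarkovKernel (act t)

theorem measurable_pulls {K t : ℕ} (i : Fin K) :
    Measurable (pulls i : History K t → ℕ) := by
  unfold pulls
  refine Finset.measurable_sum _ fun s _ => ?_
  refine Measurable.ite ?_ measurable_const measurable_const
  have h : Measurable fun h : History K t => (h s).1 := (measurable_pi_apply s).fst
  exact h (measurableSet_singleton i)

theorem measurable_weight {K : ℕ} (B : BiasModel K) {t : ℕ} (i : Fin K) :
    Measurable (B.weight i : History K t → ℝ) := by
  have h : Measurable fun k : ℕ => B.f ((B.T0 i + k) / ((∑ j, B.T0 j) + t)) :=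
    measurable_from_top
  exact h.comp (measurable_pulls i)

theorem measurable_feedbackMean {K : ℕ} (B : BiasModel K) (μ : Fin K → ℝ) (t : ℕ) :
    Measurable fun p : History K t × Fin K => μ p.2 * B.weight p.2 p.1 :=
  measurable_from_prod_countable_left fun i => (measurable_weight B i).const_mul (μ i)

/-- The law `N(μ_i W_i, 1)` of the feedback for arm `i` in round `t + 1`, given the first `t`
rounds. -/
def feedback {K : ℕ} (B : BiasModel K) (μ : Fin K → ℝ) (t : ℕ) :
    Kernel (History K t × Fin K) ℝ where
  toFun p := gaussianReal (μ p.2 * B.weight p.2 p.1) 1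
  measurable' := measurable_gaussianReal.comp
    ((measurable_feedbackMean B μ t).prodMk measurable_const)

instance {K : ℕ} (B : BiasModel K) (μ : Fin K → ℝ) (t : ℕ) :
    IsMarkovKernel (feedback B μ t) :=
  ⟨fun p => inferInstanceAs
    (IsProbabilityMeasure (gaussianReal (μ p.2 * B.weight p.2 p.1) 1))⟩

instance {K : ℕ} (π : Policy K) (t : ℕ) : IsMarkovKernel (π.act t) := π.markov t

/-- The law of the first `t` rounds of the interaction of the policy `π` with the biased
environment. -/
def historyLaw {K : ℕ} (B : BiasModel K) (μ : Fin K → ℝ) (π : Policy K) :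
    (t : ℕ) → Measure (History K t)
  | 0 => Measure.dirac Fin.elim0
  | t + 1 =>
      ((historyLaw B μ π t).compProd ((π.act t).compProd (feedback B μ t))).map
        fun p => Fin.snoc (α := fun _ => Round K) p.1 p.2

theorem measurable_snoc {K t : ℕ} :
    Measurable fun p : History K t × Round K =>
      (Fin.snoc (α := fun _ => Round K) p.1 p.2 : History K (t + 1)) := by
  refine measurable_pi_lambda _ fun s => ?_
  induction s using Fin.lastCases with
  | last => simpa using measurable_snd
  | cast s =>
    have h : Measurable fun p : History K t × Round K => p.1 s :=
      (measurable_pi_apply s).comp measurable_fst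
    simpa using h

instance {K : ℕ} (B : BiasModel K) (μ : Fin K → ℝ) (π : Policy K) (t : ℕ) :
    IsProbabilityMeasure (historyLaw B μ π t) := by
  induction t with
  | zero => exact inferInstanceAs (IsProbabilityMeasure (Measure.dirac _))
  | succ t ih => exact Measure.isProbabilityMeasure_map measurable_snoc.aemeasurable

/-- The regret `∑_i Δ_i E[T_i(n)]` of the policy `π` over `n` rounds. -/
def regret {K : ℕ} (B : BiasModel K) (μ : Fin K → ℝ) (π : Policy K) (n : ℕ) : ℝ :=
  ∑ i, gap μ i * ∫ h, (pulls i h : ℝ) ∂(historyLaw B μ π n)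

/-- Consistency of the family of policies `π n` (one for each horizon `n`, which may depend on
the bias model) for the Gaussian class, with constants `C` and `a`. -/
def IsConsistent {K : ℕ} (B : BiasModel K) (π : ℕ → Policy K) (C a : ℝ) : Prop :=
  ∀ n : ℕ, 1 ≤ n → ∀ μ ∈ gaussianClass K, regret B μ (π n) n ≤ C * (n : ℝ) ^ a

/-- `β' = C₁ γ⁻¹ (log (K/γ) + c (log K)^c')`. -/
def biasLevel (C₁ : ℝ) (K : ℕ) (γ c c' : ℝ) : ℝ :=
  C₁ / γ * (Real.log (K / γ) + c * Real.log K ^ c')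

end AffinityBandit

end

/-!
A consistent policy has to identify every suboptimal arm `i` as such. What it learns is measured by
the squared weights accumulated over the pulls of that arm, its *information*. Changing `μ_i` to a
value slightly above the best mean alters the law of the history by a likelihood ratio which, where
the information on `i` is at most `x`, is controlled in mean square by about `exp (4 Δ_i² x)`
(`historyLaw_real_sq_le`, a Cauchy-Schwarz argument carried through the rounds). In the changed
environment a consistent policy plays arm `i` most of the time, which forces the information under
`μ` to be of order `log n / Δ_i²` with high probability (`eventually_measureReal_info_lt_le`). As
weights are at most `1`, this yields the classical bound `log n / Δ_i` for the regret from each arm.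

The factor `f(β' / K)⁻²` comes from a dichotomy for the arms of `A`. A pull of an arm whose fraction
is at most `θ = β' / K` brings information at most `f(θ)²`, so an arm that is explored by such
pulls costs `f(θ)⁻² log n / Δ_i`. The other pulls are called heavy. If `m` arms each receive `b`
heavy pulls, then these arms are pulled at least `b exp (θ (m - 1))` times, initial biases included
(`BiasModel.mul_exp_le_sum_of_le_heavyPulls`): each further arm must outgrow a fraction `θ` of the
pulls of all previous ones. For `m ≥ |A| / 4 ≥ γ K / 4` the choice of `β'` makes this exponential
exceed `K f(θ)⁻²` times every power of the gap ratios that occurs (`mul_exp_le_exp_biasLevel`), so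
that a policy which explores many arms by heavy pulls has a regret above the claimed bound.

The environments that serve as alternatives also raise the worst arms by at most a small `δ`, since
the gaps have to remain in `[0, 1]` (`raise`). Only arms with gaps of at least `1 / 2` are affected,
and the information which they contribute is bounded by the regret.
-/

open MeasureTheory ProbabilityTheory

noncomputable section

namespace AffinityBandit

variable {K : ℕ}

/-! ### Pulls, fractions and weights -/

theorem pulls_succ {t : ℕ} (i : Fin K) (h : History K (t + 1)) :
    pulls i h = pulls i (Fin.init h : History K t) + if (h (Fin.last t)).1 = i then 1 else 0 := by
  unfold pulls
  rw [Fin.sum_univ_castSucc]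
  rfl

theorem sum_pulls {t : ℕ} (h : History K t) : ∑ i, pulls i h = t := by
  unfold pulls
  rw [Finset.sum_comm]
  simp

theorem BiasModel.sum_T0_pos (B : BiasModel K) (i : Fin K) : 0 < ∑ j, B.T0 j :=
  Finset.sum_pos (fun j _ => one_pos.trans_le (B.one_le_T0 j)) ⟨i, Finset.mem_univ i⟩

theorem BiasModel.sum_T0_add_pulls (B : BiasModel K) {t : ℕ} (h : History K t) :
    ∑ i, (B.T0 i + (pulls i h : ℝ)) = (∑ j, B.T0 j) + t := by
  have h1 : (∑ i, (pulls i h : ℝ)) = t := by exact_mod_cast sum_pulls h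
  rw [Finset.sum_add_distrib, h1]

theorem BiasModel.T0_add_pulls_pos (B : BiasModel K) {t : ℕ} (i : Fin K) (h : History K t) :
    0 < B.T0 i + (pulls i h : ℝ) := by
  have := B.one_le_T0 i
  positivity

theorem BiasModel.fraction_mem (B : BiasModel K) {t : ℕ} (i : Fin K) (h : History K t) :
    B.fraction i h ∈ Set.Ioc (0 : ℝ) 1 := by
  have h0 := B.sum_T0_pos i
  have hp := B.T0_add_pulls_pos i h
  refine ⟨div_pos hp (by positivity), div_le_one_of_le₀ ?_ (by positivity)⟩
  rw [← B.sum_T0_add_pulls h]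
  exact Finset.single_le_sum (f := fun i => B.T0 i + (pulls i h : ℝ))
    (fun j _ => (B.T0_add_pulls_pos j h).le) (Finset.mem_univ i)

theorem BiasModel.weight_mem (B : BiasModel K) {t : ℕ} (i : Fin K) (h : History K t) :
    B.weight i h ∈ Set.Icc (0 : ℝ) 1 := B.f_mem _ (B.fraction_mem i h)

theorem BiasModel.fbar_mono (B : BiasModel K) {x y : ℝ} (hx : 0 < x) (hxy : x ≤ y) :
    B.fbar x ≤ B.fbar y :=
  B.f_mono ⟨lt_min hx one_pos, min_le_right _ _⟩
    ⟨lt_min (hx.trans_le hxy) one_pos, min_le_right _ _⟩ (min_le_min_right _ hxy)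

theorem BiasModel.weight_le_fbar (B : BiasModel K) {t : ℕ} {i : Fin K} {h : History K t} {θ : ℝ}
    (hθ : B.fraction i h ≤ θ) : B.weight i h ≤ B.fbar θ := by
  have hm := B.fraction_mem i h
  exact B.f_mono hm ⟨lt_min (hm.1.trans_le hθ) one_pos, min_le_right _ _⟩ (le_min hθ hm.2)

/-! ### Information and heavy pulls -/

/-- The information on arm `i` collected in the first `t` rounds: the sum of the squared weights
over the rounds in which arm `i` is played. -/
def BiasModel.info (B : BiasModel K) (i : Fin K) : (t : ℕ) → History K t → ℝ
  | 0, _ => 0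
  | t + 1, h => B.info i t (Fin.init h : History K t) +
      if (h (Fin.last t)).1 = i then B.weight i (Fin.init h : History K t) ^ 2 else 0

/-- The number of rounds among the first `t` in which arm `i` is played while its fraction
exceeds `θ`. -/
def BiasModel.heavyPulls (B : BiasModel K) (θ : ℝ) (i : Fin K) : (t : ℕ) → History K t → ℕ
  | 0, _ => 0
  | t + 1, h => B.heavyPulls θ i t (Fin.init h : History K t) +
      if (h (Fin.last t)).1 = i ∧ θ < B.fraction i (Fin.init h : History K t) then 1 else 0

theorem measurable_init {t : ℕ} :
    Measurable fun h : History K (t + 1) => (Fin.init h : History K t) :=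
  measurable_pi_lambda _ fun _ => measurable_pi_apply _

theorem measurableSet_last_eq {t : ℕ} (i : Fin K) :
    MeasurableSet {h : History K (t + 1) | (h (Fin.last t)).1 = i} :=
  (measurable_pi_apply (Fin.last t)).fst (measurableSet_singleton i)

theorem BiasModel.measurable_fraction (B : BiasModel K) {t : ℕ} (i : Fin K) :
    Measurable (B.fraction i : History K t → ℝ) := by
  have h : Measurable fun k : ℕ => (B.T0 i + k) / ((∑ j, B.T0 j) + t) := measurable_from_top
  exact h.comp (measurable_pulls i)

theorem BiasModel.measurable_info (B : BiasModel K) (i : Fin K) (t : ℕ) :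
    Measurable (B.info i t) := by
  induction t with
  | zero => exact measurable_const
  | succ t ih =>
    exact (ih.comp measurable_init).add (Measurable.ite (measurableSet_last_eq i)
      (((measurable_weight B i).comp measurable_init).pow_const 2) measurable_const)

theorem BiasModel.measurable_heavyPulls (B : BiasModel K) (θ : ℝ) (i : Fin K) (t : ℕ) :
    Measurable (B.heavyPulls θ i t) := by
  induction t with
  | zero => exact measurable_const
  | succ t ih =>
    refine (ih.comp measurable_init).add (Measurable.ite ?_ measurable_const measurable_const)
    exact (measurableSet_last_eq i).inter
      (measurableSet_lt measurable_const ((B.measurable_fraction i).comp measurable_init))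

theorem BiasModel.info_nonneg (B : BiasModel K) (i : Fin K) (t : ℕ) (h : History K t) :
    0 ≤ B.info i t h := by
  induction t with
  | zero => exact le_rfl
  | succ t ih =>
    have := ih (Fin.init h)
    rw [BiasModel.info]
    split_ifs <;> positivity

theorem BiasModel.info_le_pulls (B : BiasModel K) (i : Fin K) (t : ℕ) (h : History K t) :
    B.info i t h ≤ pulls i h := by
  induction t with
  | zero => simp [BiasModel.info]
  | succ t ih =>
    have h1 := ih (Fin.init h)
    have hw := B.weight_mem i (Fin.init h : History K t)
    rw [BiasModel.info, pulls_succ]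
    split_ifs
    · push_cast
      exact add_le_add h1 (pow_le_one₀ hw.1 hw.2)
    · simpa using h1

theorem BiasModel.heavyPulls_le_pulls (B : BiasModel K) (θ : ℝ) (i : Fin K) (t : ℕ)
    (h : History K t) : B.heavyPulls θ i t h ≤ pulls i h := by
  induction t with
  | zero => simp [BiasModel.heavyPulls]
  | succ t ih =>
    have h1 := ih (Fin.init h)
    rw [BiasModel.heavyPulls, pulls_succ]
    split_ifs <;> omega

/-- A pull at a fraction of at most `θ` contributes at most `f(θ)²` to the information, and a
heavy pull contributes at most `1`. -/
theorem BiasModel.info_le_fbar_sq_mul_pulls_add_heavyPulls (B : BiasModel K) {θ : ℝ} (i : Fin K)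
    (t : ℕ) (h : History K t) :
    B.info i t h ≤ B.fbar θ ^ 2 * pulls i h + B.heavyPulls θ i t h := by
  induction t with
  | zero => simp [BiasModel.info, BiasModel.heavyPulls, pulls]
  | succ t ih =>
    have h1 := ih (Fin.init h)
    have hw := B.weight_mem i (Fin.init h : History K t)
    rw [BiasModel.info, pulls_succ, BiasModel.heavyPulls]
    by_cases hi : (h (Fin.last t)).1 = i
    · by_cases hθ' : θ < B.fraction i (Fin.init h : History K t)
      · have := pow_le_one₀ hw.1 hw.2 (n := 2)
        simp only [hi, hθ', and_self, if_true]
        push_cast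
        nlinarith [sq_nonneg (B.fbar θ)]
      · have := pow_le_pow_left₀ hw.1 (B.weight_le_fbar (not_lt.1 hθ')) 2
        simp only [hi, hθ', and_false, if_true, if_false]
        push_cast
        nlinarith
    · simpa [hi] using h1

/-- If the arms of a nonempty set `G` have each been pulled heavily at least `b` times, then they
have been pulled exponentially often in `|G|`. When the last arm of `G` makes its `b`-th heavy pull,
it holds a fraction above `θ` of all pulls, those of the other arms of `G` included, so that adding
it multiplies the total over the others by at least `1 / (1 - θ) ≥ exp θ`. -/
theorem BiasModel.mul_exp_le_sum_of_le_heavyPulls (B : BiasModel K) {θ b : ℝ} (hb : 0 < b)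
    (t : ℕ) (h : History K t) (G : Finset (Fin K)) (hG : G.Nonempty)
    (hh : ∀ i ∈ G, b ≤ B.heavyPulls θ i t h) :
    b * Real.exp (θ * (G.card - 1)) ≤ ∑ i ∈ G, (B.T0 i + (pulls i h : ℝ)) := by
  induction t generalizing G with
  | zero =>
    obtain ⟨i, hi⟩ := hG
    have := hh i hi
    simp only [BiasModel.heavyPulls, Nat.cast_zero] at this
    exact absurd this (not_le.2 hb)
  | succ t ih =>
    set h' : History K t := Fin.init h with hh'
    have hmono : ∀ i, (pulls i h' : ℝ) ≤ pulls i h := fun i => by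
      rw [pulls_succ i h]
      exact_mod_cast Nat.le_add_right _ _
    by_cases hall : ∀ i ∈ G, b ≤ B.heavyPulls θ i t h'
    · exact (ih h' G hG hall).trans
        (Finset.sum_le_sum fun i _ => add_le_add le_rfl (hmono i))
    push Not at hall
    obtain ⟨k, hkG, hk⟩ := hall
    -- The arm `k` is the one that completes its `b` heavy pulls in the current round.
    have hplay : (h (Fin.last t)).1 = k ∧ θ < B.fraction k h' := by
      by_contra hne
      have := hh k hkG
      rw [BiasModel.heavyPulls, if_neg hne, add_zero] at this
      exact absurd this (not_le.2 hk)
    have hother : ∀ i ∈ G.erase k, b ≤ B.heavyPulls θ i t h' := fun i hi => by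
      have h1 := hh i (Finset.mem_of_mem_erase hi)
      rw [BiasModel.heavyPulls, if_neg, add_zero] at h1
      · exact h1
      · rintro ⟨h2, -⟩
        exact Finset.ne_of_mem_erase hi (h2.symm.trans hplay.1)
    rw [← Finset.add_sum_erase G _ hkG]
    rcases (G.erase k).eq_empty_or_nonempty with hE | hE
    · have hcard : G.card = 1 := by
        rw [← Finset.card_erase_add_one hkG, hE, Finset.card_empty]
      have h1 : (B.heavyPulls θ k (t + 1) h : ℝ) ≤ pulls k h := by
        exact_mod_cast B.heavyPulls_le_pulls θ k (t + 1) h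
      have h2 := B.one_le_T0 k
      have h3 := hh k hkG
      rw [hcard, hE]
      simp only [Nat.cast_one, sub_self, mul_zero, Real.exp_zero, Finset.sum_empty]
      linarith
    · have hs := ih h' (G.erase k) hE hother
      set s : ℝ := ∑ i ∈ G.erase k, (B.T0 i + (pulls i h' : ℝ)) with hsdef
      set x : ℝ := B.T0 k + (pulls k h' : ℝ) with hx
      have hs0 : 0 < s := Finset.sum_pos (fun i _ => B.T0_add_pulls_pos i h') hE
      have hx0 : 0 < x := B.T0_add_pulls_pos k h'
      have htot : x + s ≤ (∑ j, B.T0 j) + t := by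
        rw [← B.sum_T0_add_pulls h', hx, hsdef,
          Finset.add_sum_erase G (fun i => B.T0 i + (pulls i h' : ℝ)) hkG]
        exact Finset.sum_le_univ_sum_of_nonneg fun i => (B.T0_add_pulls_pos i h').le
      have hfrac : θ * (x + s) < x := by
        have h1 := hplay.2
        rw [BiasModel.fraction, lt_div_iff₀ (by linarith)] at h1
        rcases le_or_gt 0 θ with hθ | hθ
        · exact (mul_le_mul_of_nonneg_left htot hθ).trans_lt h1
        · nlinarith
      have hgrow : s * Real.exp θ ≤ x + s := by
        have h1 : s ≤ (x + s) * Real.exp (-θ) := by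
          have := Real.one_sub_le_exp_neg θ
          nlinarith
        calc s * Real.exp θ ≤ (x + s) * Real.exp (-θ) * Real.exp θ := by gcongr
          _ = x + s := by rw [mul_assoc, ← Real.exp_add]; simp
      have hcard : (G.card : ℝ) = (G.erase k).card + 1 := by
        rw [← Finset.card_erase_add_one hkG]; push_cast; rfl
      calc b * Real.exp (θ * (G.card - 1))
          = b * Real.exp (θ * ((G.erase k).card - 1)) * Real.exp θ := by
            rw [mul_assoc, ← Real.exp_add, hcard]; ring_nf
        _ ≤ s * Real.exp θ := by gcongr
        _ ≤ x + s := hgrow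
        _ ≤ _ := add_le_add (add_le_add le_rfl (hmono k))
            (Finset.sum_le_sum fun i _ => add_le_add le_rfl (hmono i))

/-! ### Change of measure -/

open ENNReal in
/-- Change of measure between two normal laws: Cauchy-Schwarz, together with the chi-square
integral `∫ p_m² / p_{m'} = exp ((m - m')²)` for the normal densities, in which the square
`p_m²` equals `exp ((m - m')²) p_{m'} p_{2m - m'}`. -/
theorem lintegral_gaussianReal_mul_exp_le (m m' : ℝ) {g : ℝ → ℝ≥0∞} (hg : Measurable g) :
    ENNReal.ofReal (Real.exp (-(m - m') ^ 2 / 2)) * ∫⁻ y, g y ∂(gaussianReal m 1) ≤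
      (∫⁻ y, g y ^ (2 : ℝ) ∂(gaussianReal m' 1)) ^ (1 / 2 : ℝ) := by
  have h1 : (1 : NNReal) ≠ 0 := one_ne_zero
  have key : ∀ y, ENNReal.ofReal (Real.exp (-(m - m') ^ 2 / 2)) * gaussianPDF m 1 y =
      gaussianPDF m' 1 y ^ (1 / 2 : ℝ) * gaussianPDF (2 * m - m') 1 y ^ (1 / 2 : ℝ) := by
    intro y
    rw [← ENNReal.mul_rpow_of_nonneg _ _ (by norm_num : (0 : ℝ) ≤ 1 / 2)]
    simp only [gaussianPDF]
    rw [← ENNReal.ofReal_mul (gaussianPDFReal_nonneg _ _ _),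
      ← ENNReal.ofReal_mul (Real.exp_nonneg _),
      ENNReal.ofReal_rpow_of_nonneg (mul_nonneg (gaussianPDFReal_nonneg _ _ _)
        (gaussianPDFReal_nonneg _ _ _)) (by norm_num), ← Real.sqrt_eq_rpow]
    congr 1
    symm
    rw [Real.sqrt_eq_iff_mul_self_eq_of_pos]
    · simp only [gaussianPDFReal]
      rw [show ∀ E u A : ℝ, E * (u * A) * (E * (u * A)) = u * u * (E * E * (A * A)) by intros; ring,
        show ∀ u A C : ℝ, u * A * (u * C) = u * u * (A * C) by intros; ring]
      simp only [← Real.exp_add]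
      congr 2
      push_cast
      ring
    · exact mul_pos (Real.exp_pos _) (gaussianPDFReal_pos _ _ _ h1)
  have hmeas := fun μ => (measurable_gaussianPDF μ 1)
  rw [gaussianReal_of_var_ne_zero _ h1, gaussianReal_of_var_ne_zero _ h1,
    lintegral_withDensity_eq_lintegral_mul _ (hmeas m) hg,
    lintegral_withDensity_eq_lintegral_mul _ (hmeas m') (hg.pow_const _),
    ← lintegral_const_mul _ ((hmeas m).mul hg)]
  have hq : (2 : ℝ).HolderConjugate 2 := Real.HolderConjugate.two_two
  have := ENNReal.lintegral_mul_le_Lp_mul_Lq volume hq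
    (f := fun y => gaussianPDF m' 1 y ^ (1 / 2 : ℝ) * g y)
    (g := fun y => gaussianPDF (2 * m - m') 1 y ^ (1 / 2 : ℝ))
    (((hmeas _).pow_const _).mul hg).aemeasurable ((hmeas _).pow_const _).aemeasurable
  have e2 : ∀ x : ℝ≥0∞, (x ^ (1 / 2 : ℝ)) ^ (2 : ℝ) = x := fun x => by
    rw [← ENNReal.rpow_mul]; norm_num
  simp only [ENNReal.mul_rpow_of_nonneg _ _ (zero_le_two : (0 : ℝ) ≤ 2), e2,
    lintegral_gaussianPDF_eq_one _ h1, ENNReal.one_rpow, mul_one] at this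
  refine le_trans (le_of_eq (lintegral_congr fun y => ?_)) this
  simp only [Pi.mul_apply]
  rw [← mul_assoc, key]
  ring

theorem lintegral_historyLaw_succ (B : BiasModel K) (μ : Fin K → ℝ) (π : Policy K) (t : ℕ)
    {g : History K (t + 1) → ENNReal} (hg : Measurable g) :
    ∫⁻ h, g h ∂(historyLaw B μ π (t + 1)) =
      ∫⁻ h, ∫⁻ i, ∫⁻ y, g (Fin.snoc (α := fun _ => Round K) h (i, y))
        ∂(gaussianReal (μ i * B.weight i h) 1) ∂(π.act t h) ∂(historyLaw B μ π t) := by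
  have hgs : Measurable fun p : History K t × Round K =>
      g (Fin.snoc (α := fun _ => Round K) p.1 p.2) := hg.comp measurable_snoc
  rw [historyLaw, lintegral_map hg measurable_snoc, Measure.lintegral_compProd hgs]
  refine lintegral_congr fun h => ?_
  exact Kernel.lintegral_compProd _ _ _ (hgs.comp measurable_prodMk_left)

/-- The squared distance between the mean feedbacks in the environments `μ` and `μ'`, summed along
a history of `t` rounds. -/
def BiasModel.discrepancy (B : BiasModel K) (μ μ' : Fin K → ℝ) (t : ℕ) (h : History K t) : ℝ :=
  ∑ i, (μ i - μ' i) ^ 2 * B.info i t h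

theorem BiasModel.measurable_discrepancy (B : BiasModel K) (μ μ' : Fin K → ℝ) (t : ℕ) :
    Measurable (B.discrepancy μ μ' t) :=
  Finset.measurable_sum _ fun i _ => (B.measurable_info i t).const_mul _

theorem BiasModel.discrepancy_snoc (B : BiasModel K) (μ μ' : Fin K → ℝ) (t : ℕ) (h : History K t)
    (i : Fin K) (y : ℝ) :
    B.discrepancy μ μ' (t + 1) (Fin.snoc (α := fun _ => Round K) h (i, y)) =
      B.discrepancy μ μ' t h + (μ i * B.weight i h - μ' i * B.weight i h) ^ 2 := by
  simp only [BiasModel.discrepancy, BiasModel.info, Fin.init_snoc, Fin.snoc_last, mul_add,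
    Finset.sum_add_distrib, mul_ite, mul_zero, Finset.sum_ite_eq, Finset.mem_univ, if_true]
  ring

/-- Change of measure for the interaction: on histories whose accumulated discrepancy is `D`, the
likelihood ratio of two environments behaves in mean square like `exp D`. Stated in dual form, it
follows round by round from the inequality for two normal laws. -/
theorem lintegral_historyLaw_mul_exp_le (B : BiasModel K) (μ μ' : Fin K → ℝ) (π : Policy K) (t : ℕ)
    {g : History K t → ENNReal} (hg : Measurable g) :
    ∫⁻ h, ENNReal.ofReal (Real.exp (-B.discrepancy μ μ' t h / 2)) * g h ∂(historyLaw B μ π t) ≤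
      (∫⁻ h, g h ^ (2 : ℝ) ∂(historyLaw B μ' π t)) ^ (1 / 2 : ℝ) := by
  have e2 : ∀ x : ENNReal, (x ^ (1 / 2 : ℝ)) ^ (2 : ℝ) = x := fun x => by
    rw [← ENNReal.rpow_mul]; norm_num
  have e3 : ∀ x : ENNReal, (x ^ (2 : ℝ)) ^ (1 / 2 : ℝ) = x := fun x => by
    rw [← ENNReal.rpow_mul]; norm_num
  induction t with
  | zero =>
    have hdirac : ∀ ν : Fin K → ℝ, historyLaw B ν π 0 = Measure.dirac Fin.elim0 := fun _ => rfl
    rw [hdirac, hdirac, lintegral_dirac' _ (hg.pow_const _), lintegral_dirac' _ (by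
      exact (((B.measurable_discrepancy μ μ' 0).neg.div_const 2).exp.ennreal_ofReal).mul hg), e3]
    simp [BiasModel.discrepancy, BiasModel.info]
  | succ t ih =>
    have hgs := hg.comp (measurable_snoc (K := K) (t := t))
    have hD : Measurable fun h => ENNReal.ofReal
        (Real.exp (-B.discrepancy μ μ' (t + 1) h / 2)) :=
      ((B.measurable_discrepancy μ μ' (t + 1)).neg.div_const 2).exp.ennreal_ofReal
    have hDg : Measurable fun h => ENNReal.ofReal
        (Real.exp (-B.discrepancy μ μ' (t + 1) h / 2)) * g h := hD.mul hg
    rw [lintegral_historyLaw_succ B μ π t hDg,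
      lintegral_historyLaw_succ B μ' π t (hg.pow_const _)]
    -- `F h i` is the mean square of `g` under `μ'`, given the past `h` and the next arm `i`.
    set F : History K t → Fin K → ENNReal := fun h i =>
      ∫⁻ y, g (Fin.snoc (α := fun _ => Round K) h (i, y)) ^ (2 : ℝ)
        ∂(gaussianReal (μ' i * B.weight i h) 1) with hF
    have hFm : Measurable fun h => ∫⁻ i, F h i ∂(π.act t h) := by
      have h1 : Measurable fun p : History K t × Fin K => F p.1 p.2 := by
        have h2 : Measurable fun q : (History K t × Fin K) × ℝ =>
            g (Fin.snoc (α := fun _ => Round K) q.1.1 (q.1.2, q.2)) ^ (2 : ℝ) :=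
          (hgs.comp ((measurable_fst.comp measurable_fst).prodMk
            ((measurable_snd.comp measurable_fst).prodMk measurable_snd))).pow_const _
        exact h2.lintegral_kernel_prod_right' (κ := feedback B μ' t)
      exact h1.lintegral_kernel_prod_right' (κ := π.act t)
    calc _ ≤ ∫⁻ h, ENNReal.ofReal (Real.exp (-B.discrepancy μ μ' t h / 2)) *
          (∫⁻ i, F h i ∂(π.act t h)) ^ (1 / 2 : ℝ) ∂(historyLaw B μ π t) := by
          refine lintegral_mono fun h => ?_
          have hgi : ∀ i, Measurable fun y => g (Fin.snoc (α := fun _ => Round K) h (i, y)) :=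
            fun i => hgs.comp (measurable_prodMk_left.comp measurable_prodMk_left)
          calc _ ≤ ∫⁻ i, ENNReal.ofReal (Real.exp (-B.discrepancy μ μ' t h / 2)) *
                (F h i) ^ (1 / 2 : ℝ) ∂(π.act t h) := by
                refine lintegral_mono fun i => ?_
                refine le_trans (le_of_eq ?_) (mul_le_mul_right (lintegral_gaussianReal_mul_exp_le
                  (μ i * B.weight i h) (μ' i * B.weight i h) (hgi i)) _)
                rw [← mul_assoc, ← ENNReal.ofReal_mul (Real.exp_nonneg _), ← Real.exp_add,
                  ← lintegral_const_mul _ (hgi i)]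
                refine lintegral_congr fun y => ?_
                rw [B.discrepancy_snoc]
                congr 3
                ring
            _ = ENNReal.ofReal (Real.exp (-B.discrepancy μ μ' t h / 2)) *
                ∫⁻ i, (F h i) ^ (1 / 2 : ℝ) ∂(π.act t h) :=
                lintegral_const_mul _ (measurable_of_countable _)
            _ ≤ _ := by
                refine mul_le_mul_right ?_ _
                have := ENNReal.lintegral_mul_le_Lp_mul_Lq (π.act t h)
                  Real.HolderConjugate.two_two (f := fun i => F h i ^ (1 / 2 : ℝ))
                  (g := fun _ => 1) (measurable_of_countable _).aemeasurable
                  measurable_const.aemeasurable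
                simpa only [Pi.mul_apply, mul_one, e2, ENNReal.one_rpow, lintegral_one,
                  measure_univ] using this
      _ ≤ (∫⁻ h, ((∫⁻ i, F h i ∂(π.act t h)) ^ (1 / 2 : ℝ)) ^ (2 : ℝ)
            ∂(historyLaw B μ' π t)) ^ (1 / 2 : ℝ) := ih (hFm.pow_const _)
      _ = _ := by simp only [e2]; rfl

/-- The probabilities of an event in two environments are comparable if the accumulated
discrepancy is bounded on the event. -/
theorem historyLaw_real_sq_le (B : BiasModel K) (μ μ' : Fin K → ℝ) (π : Policy K) (t : ℕ)
    {E : Set (History K t)} (hE : MeasurableSet E) {x : ℝ}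
    (hx : ∀ h ∈ E, B.discrepancy μ μ' t h ≤ x) :
    (historyLaw B μ π t).real E ^ 2 ≤ Real.exp x * (historyLaw B μ' π t).real E := by
  have h1 := lintegral_historyLaw_mul_exp_le B μ μ' π t
    (g := E.indicator fun _ => 1) (measurable_const.indicator hE)
  have h2 : ENNReal.ofReal (Real.exp (-x / 2)) * historyLaw B μ π t E ≤
      ∫⁻ h, ENNReal.ofReal (Real.exp (-B.discrepancy μ μ' t h / 2)) * E.indicator (fun _ => 1) h
        ∂(historyLaw B μ π t) := by
    rw [← lintegral_indicator_one hE, ← lintegral_const_mul _ (measurable_one.indicator hE)]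
    refine lintegral_mono fun h => ?_
    by_cases hh : h ∈ E
    · simp only [hh, Set.indicator_of_mem, Pi.one_apply, mul_one]
      exact ENNReal.ofReal_le_ofReal (Real.exp_le_exp.2 (by linarith [hx h hh]))
    · simp [hh]
  have h3 : ∫⁻ h, (E.indicator (fun _ => (1 : ENNReal)) h) ^ (2 : ℝ) ∂(historyLaw B μ' π t) =
      historyLaw B μ' π t E := by
    rw [← lintegral_indicator_one hE]
    refine lintegral_congr fun h => ?_
    by_cases hh : h ∈ E <;> simp [hh]
  rw [h3] at h1
  have h4 := ENNReal.toReal_mono (ENNReal.rpow_ne_top_of_nonneg (by norm_num)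
    (measure_ne_top _ _)) (h2.trans h1)
  rw [ENNReal.toReal_mul, ENNReal.toReal_ofReal (Real.exp_nonneg _), ← ENNReal.toReal_rpow,
    ← Real.sqrt_eq_rpow] at h4
  change Real.exp (-x / 2) * (historyLaw B μ π t).real E ≤
    √((historyLaw B μ' π t).real E) at h4
  have h5 := pow_le_pow_left₀ (by positivity) h4 2
  rw [Real.sq_sqrt measureReal_nonneg, mul_pow, ← Real.exp_nat_mul] at h5
  calc (historyLaw B μ π t).real E ^ 2
      = Real.exp x * (Real.exp ((2 : ℕ) * (-x / 2)) * (historyLaw B μ π t).real E ^ 2) := by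
        rw [← mul_assoc, ← Real.exp_add]
        have : x + (2 : ℕ) * (-x / 2) = 0 := by push_cast; ring
        rw [this, Real.exp_zero, one_mul]
    _ ≤ _ := by gcongr

/-! ### Regret and expected numbers of pulls -/

theorem integrable_pulls (B : BiasModel K) (μ : Fin K → ℝ) (π : Policy K) (n : ℕ) (i : Fin K) :
    Integrable (fun h : History K n => (pulls i h : ℝ)) (historyLaw B μ π n) := by
  refine Integrable.of_bound (C := n)
    ((measurable_from_top (f := fun k : ℕ => (k : ℝ))).comp
      (measurable_pulls i)).aestronglyMeasurable (Filter.Eventually.of_forall fun h => ?_)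
  have := Finset.single_le_sum (f := fun i => pulls i h) (fun _ _ => Nat.zero_le _)
    (Finset.mem_univ i)
  rw [sum_pulls h] at this
  rw [Real.norm_of_nonneg (Nat.cast_nonneg _)]
  exact_mod_cast this

theorem regret_eq_integral (B : BiasModel K) (μ : Fin K → ℝ) (π : Policy K) (n : ℕ) :
    regret B μ π n = ∫ h, ∑ i, gap μ i * (pulls i h : ℝ) ∂(historyLaw B μ π n) := by
  rw [integral_finsetSum _ fun i _ => (integrable_pulls B μ π n i).const_mul _]
  simp only [integral_const_mul, regret]

theorem mul_measureReal_le_integral_pulls (B : BiasModel K) (μ : Fin K → ℝ) (π : Policy K) {n : ℕ}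
    (i : Fin K) {y : ℝ} (hy : 0 ≤ y) {E : Set (History K n)} (hE : ∀ h ∈ E, y ≤ pulls i h) :
    y * (historyLaw B μ π n).real E ≤ ∫ h, (pulls i h : ℝ) ∂(historyLaw B μ π n) :=
  (mul_le_mul_of_nonneg_left (measureReal_mono hE) hy).trans
    (mul_meas_ge_le_integral_of_nonneg (Filter.Eventually.of_forall fun _ => Nat.cast_nonneg _)
      (integrable_pulls B μ π n i) y)

theorem mul_measureReal_le_regret (B : BiasModel K) {μ : Fin K → ℝ} (hμ : μ ∈ gaussianClass K)
    (π : Policy K) {n : ℕ} {y : ℝ} (hy : 0 ≤ y) {E : Set (History K n)}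
    (hE : ∀ h ∈ E, y ≤ ∑ i, gap μ i * (pulls i h : ℝ)) :
    y * (historyLaw B μ π n).real E ≤ regret B μ π n := by
  rw [regret_eq_integral]
  refine (mul_le_mul_of_nonneg_left (measureReal_mono hE) hy).trans
    (mul_meas_ge_le_integral_of_nonneg (Filter.Eventually.of_forall fun h =>
      Finset.sum_nonneg fun i _ => mul_nonneg (hμ i).1 (Nat.cast_nonneg _))
      (integrable_finsetSum _ fun i _ => (integrable_pulls B μ π n i).const_mul _) y)

/-! ### Information forced by consistency -/

/-- The environment in which arm `i` is better by `δ` than the best arm of `μ`. The means of the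
worst arms are raised as well, by at most `δ`, to keep all gaps within `[0, 1]`. -/
def raise (μ : Fin K → ℝ) (i : Fin K) (δ : ℝ) (j : Fin K) : ℝ :=
  if j = i then (⨆ k, μ k) + δ else max (μ j) ((⨆ k, μ k) + δ - 1)

theorem raise_le (μ : Fin K → ℝ) (i : Fin K) {δ : ℝ} (hδ : 0 < δ) (j : Fin K) :
    raise μ i δ j ≤ (⨆ k, μ k) + δ := by
  have := le_ciSup (Set.finite_range μ).bddAbove j
  unfold raise
  split_ifs
  · exact le_rfl
  · exact max_le (by linarith) (by linarith)

theorem iSup_raise (μ : Fin K → ℝ) (i : Fin K) {δ : ℝ} (hδ : 0 < δ) :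
    ⨆ j, raise μ i δ j = (⨆ k, μ k) + δ := by
  have : Nonempty (Fin K) := ⟨i⟩
  refine le_antisymm (ciSup_le (raise_le μ i hδ)) ?_
  calc (⨆ k, μ k) + δ = raise μ i δ i := (if_pos rfl).symm
    _ ≤ _ := le_ciSup (Set.finite_range (raise μ i δ)).bddAbove i

theorem raise_mem (μ : Fin K → ℝ) (i : Fin K) {δ : ℝ} (hδ : 0 < δ) :
    raise μ i δ ∈ gaussianClass K := by
  intro j
  have := raise_le μ i hδ j
  rw [gap, iSup_raise μ i hδ]
  refine ⟨by linarith, ?_⟩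
  unfold raise
  split_ifs
  · linarith
  · linarith [le_max_right (μ j) ((⨆ k, μ k) + δ - 1)]

theorem le_gap_raise (μ : Fin K → ℝ) {i j : Fin K} (hj : j ≠ i) {δ : ℝ} (hδ : 0 < δ)
    (hδ1 : δ ≤ 1) : δ ≤ gap (raise μ i δ) j := by
  have := le_ciSup (Set.finite_range μ).bddAbove j
  rw [gap, iSup_raise μ i hδ, raise, if_neg hj]
  have : max (μ j) ((⨆ k, μ k) + δ - 1) ≤ ⨆ k, μ k := max_le this (by linarith)
  linarith

/-- The arms whose means are raised have gaps of at least `1 - δ ≥ 1 / 2`, so that the discrepancy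
they cause is controlled by the regret. -/
theorem discrepancy_raise_le (B : BiasModel K) {μ : Fin K → ℝ} (hμ : μ ∈ gaussianClass K)
    (i : Fin K) {δ : ℝ} (hδ : 0 < δ) (hδ1 : δ ≤ 1 / 2) {n : ℕ} (h : History K n) :
    B.discrepancy μ (raise μ i δ) n h ≤
      (gap μ i + δ) ^ 2 * B.info i n h + 2 * δ ^ 2 * ∑ j, gap μ j * (pulls j h : ℝ) := by
  have : (gap μ i + δ) ^ 2 * B.info i n h + 2 * δ ^ 2 * ∑ j, gap μ j * (pulls j h : ℝ) =
      ∑ j, ((if j = i then (gap μ i + δ) ^ 2 * B.info i n h else 0) +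
        2 * δ ^ 2 * (gap μ j * (pulls j h : ℝ))) := by
    rw [Finset.sum_add_distrib, Finset.mul_sum]
    simp
  rw [this, BiasModel.discrepancy]
  refine Finset.sum_le_sum fun j _ => ?_
  have hp : (0 : ℝ) ≤ pulls j h := Nat.cast_nonneg _
  have hI := B.info_le_pulls j n h
  have hI0 := B.info_nonneg j n h
  obtain ⟨hg0, hg1⟩ := hμ j
  by_cases hj : j = i
  · subst hj
    have e : (μ j - raise μ j δ j) ^ 2 = (gap μ j + δ) ^ 2 := by
      simp only [raise, gap, if_true]; ring
    rw [e, if_pos rfl]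
    have : 0 ≤ 2 * δ ^ 2 * (gap μ j * (pulls j h : ℝ)) := by positivity
    linarith
  · rw [if_neg hj, zero_add]
    have e : (μ j - raise μ i δ j) ^ 2 ≤ 2 * δ ^ 2 * gap μ j := by
      simp only [raise, if_neg hj]
      have hm : (⨆ k, μ k) = μ j + gap μ j := by simp [gap]
      rcases le_total (μ j) ((⨆ k, μ k) + δ - 1) with hle | hle
      · rw [max_eq_right hle]
        have h1 : 0 ≤ ((⨆ k, μ k) + δ - 1) - μ j := by linarith
        have h2 : ((⨆ k, μ k) + δ - 1) - μ j ≤ δ := by linarith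
        have h3 : 1 / 2 ≤ gap μ j := by linarith
        nlinarith [pow_le_pow_left₀ h1 h2 2, sq_nonneg δ]
      · rw [max_eq_left hle, sub_self]
        have : 0 ≤ 2 * δ ^ 2 * gap μ j := by positivity
        simpa using this
    calc (μ j - raise μ i δ j) ^ 2 * B.info j n h
        ≤ 2 * δ ^ 2 * gap μ j * (pulls j h : ℝ) := mul_le_mul e hI hI0 (by positivity)
      _ = _ := by ring

/-- In the environment in which arm `i` is the best, a consistent policy rarely plays it in at most
half of the rounds. -/
theorem measureReal_raise_le (B : BiasModel K) (μ : Fin K → ℝ) (i : Fin K) {δ : ℝ} (hδ : 0 < δ)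
    (hδ1 : δ ≤ 1) {π : ℕ → Policy K} {C a : ℝ} (hπ : IsConsistent B π C a) {n : ℕ} (hn : 1 ≤ n)
    {E : Set (History K n)} (hE : ∀ h ∈ E, (pulls i h : ℝ) ≤ n / 2) :
    δ * (n / 2) * (historyLaw B (raise μ i δ) (π n) n).real E ≤ C * (n : ℝ) ^ a := by
  refine le_trans (mul_measureReal_le_regret B (raise_mem μ i hδ) (π n) (by positivity)
    fun h hh => ?_) (hπ n hn _ (raise_mem μ i hδ))
  have h1 : (∑ j, (pulls j h : ℝ)) = n := by exact_mod_cast sum_pulls h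
  have h2 : ∑ j ∈ Finset.univ.erase i, (pulls j h : ℝ) = n - pulls i h := by
    rw [← h1, ← Finset.add_sum_erase _ _ (Finset.mem_univ i)]; ring
  calc δ * (n / 2) ≤ δ * ∑ j ∈ Finset.univ.erase i, (pulls j h : ℝ) := by
        rw [h2]; exact mul_le_mul_of_nonneg_left (by linarith [hE h hh]) hδ.le
    _ ≤ ∑ j ∈ Finset.univ.erase i, gap (raise μ i δ) j * (pulls j h : ℝ) := by
        rw [Finset.mul_sum]
        exact Finset.sum_le_sum fun j hj => mul_le_mul_of_nonneg_right
          (le_gap_raise μ (Finset.ne_of_mem_erase hj) hδ hδ1) (Nat.cast_nonneg _)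
    _ ≤ _ := Finset.sum_le_sum_of_subset_of_nonneg (Finset.erase_subset _ _) fun j _ _ =>
        mul_nonneg (raise_mem μ i hδ j).1 (Nat.cast_nonneg _)

/-- A consistent policy of logarithmic regret collects, with high probability, information of order
`log n / Δ_i²` on every suboptimal arm `i`: otherwise it could not tell the environment from one in
which arm `i` is the best. -/
theorem eventually_measureReal_info_lt_le (B : BiasModel K) {μ : Fin K → ℝ}
    (hμ : μ ∈ gaussianClass K) {C a M p : ℝ} (ha : a < 1) (hM : 0 ≤ M) (hp : 0 < p)
    {i : Fin K} (hi : 0 < gap μ i) :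
    ∀ᶠ n : ℕ in Filter.atTop, ∀ π : ℕ → Policy K, IsConsistent B π C a →
      regret B μ (π n) n ≤ M * Real.log n →
      (historyLaw B μ (π n) n).real
        {h | B.info i n h < (1 - a) * Real.log n / (16 * gap μ i ^ 2)} ≤ p := by
  have ha' : 0 < 1 - a := by linarith
  obtain ⟨δ, hδ, hδi, hδ1, hδp⟩ : ∃ δ : ℝ, 0 < δ ∧ δ ≤ gap μ i ∧ δ ≤ 1 / 2 ∧
      24 * δ ^ 2 * M ≤ p * (1 - a) := by
    refine ⟨min (gap μ i) (min (1 / 2) (p * (1 - a) / (24 * (M + 1)))), by positivity,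
      min_le_left _ _, (min_le_right _ _).trans (min_le_left _ _), ?_⟩
    set δ := min (gap μ i) (min (1 / 2) (p * (1 - a) / (24 * (M + 1)))) with hδ
    have h0 : 0 < δ := by positivity
    have h1 : δ ≤ 1 / 2 := (min_le_right _ _).trans (min_le_left _ _)
    have h2 : δ ≤ p * (1 - a) / (24 * (M + 1)) := (min_le_right _ _).trans (min_le_right _ _)
    rw [le_div_iff₀ (by positivity)] at h2
    nlinarith [mul_nonneg h0.le hM]
  have hev1 : ∀ᶠ n : ℕ in Filter.atTop, M * Real.log n ≤ p / 3 * (gap μ i / 2) * n := by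
    have h1 := (Real.isLittleO_log_id_atTop.const_mul_left M).comp_tendsto
      tendsto_natCast_atTop_atTop
    filter_upwards [h1.bound (show 0 < p / 3 * (gap μ i / 2) by positivity)] with n hn
    simpa using (Real.le_norm_self _).trans hn
  have hev2 : ∀ᶠ n : ℕ in Filter.atTop,
      C * (n : ℝ) ^ ((1 + a) / 2) ≤ (p / 3) ^ 2 * (δ / 2) * n := by
    have h1 : Filter.Tendsto (fun n : ℕ => C * (n : ℝ) ^ (-((1 - a) / 2))) Filter.atTop
        (nhds (C * 0)) :=
      ((tendsto_rpow_neg_atTop (by positivity)).comp tendsto_natCast_atTop_atTop).const_mul C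
    rw [mul_zero] at h1
    filter_upwards [h1.eventually_le_const (show 0 < (p / 3) ^ 2 * (δ / 2) by positivity),
      Filter.eventually_ge_atTop 1] with n hn hn1
    have hn0 : (0 : ℝ) < n := by exact_mod_cast hn1
    calc C * (n : ℝ) ^ ((1 + a) / 2) = C * (n : ℝ) ^ (-((1 - a) / 2)) * n := by
          rw [mul_assoc, ← Real.rpow_add_one hn0.ne']
          congr 2; ring
      _ ≤ _ := by gcongr
  filter_upwards [hev1, hev2, Filter.eventually_ge_atTop 2] with n hn1 hn2 hn π hπ hR
  have hn0 : (0 : ℝ) < n := by exact_mod_cast (by omega : 0 < n)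
  have hlog : 0 < Real.log n := Real.log_pos (by exact_mod_cast hn)
  set P := historyLaw B μ (π n) n with hP
  set x : ℝ := (1 - a) * Real.log n / (16 * gap μ i ^ 2) with hx
  set y : ℝ := (1 - a) * Real.log n / (8 * δ ^ 2) with hy
  have hy0 : 0 < y := by positivity
  -- If the information on arm `i` is below `x`, then arm `i` is played very often, or the regret
  -- along the history is exceptionally large, or the history is about as likely in the environment
  -- with arm `i` raised.
  set E1 : Set (History K n) := {h | (n : ℝ) / 2 < pulls i h} with hE1
  set E2 : Set (History K n) := {h | y < ∑ j, gap μ j * (pulls j h : ℝ)} with hE2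
  set E3 : Set (History K n) := {h | B.info i n h < x ∧ (pulls i h : ℝ) ≤ n / 2 ∧
    ∑ j, gap μ j * (pulls j h : ℝ) ≤ y} with hE3
  have hsub : {h | B.info i n h < x} ⊆ E1 ∪ E2 ∪ E3 := by
    intro h hh
    by_cases h1 : (n : ℝ) / 2 < pulls i h
    · exact Or.inl (Or.inl h1)
    by_cases h2 : y < ∑ j, gap μ j * (pulls j h : ℝ)
    · exact Or.inl (Or.inr h2)
    exact Or.inr ⟨hh, not_lt.1 h1, not_lt.1 h2⟩
  have hP1 : P.real E1 ≤ p / 3 := by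
    have h1 := mul_measureReal_le_regret B hμ (π n) (y := gap μ i * (n / 2)) (by positivity)
      (E := E1) fun h hh => (mul_le_mul_of_nonneg_left (le_of_lt hh) hi.le).trans
        (Finset.single_le_sum (f := fun j => gap μ j * (pulls j h : ℝ))
          (fun j _ => mul_nonneg (hμ j).1 (Nat.cast_nonneg _)) (Finset.mem_univ i))
    have h2 : gap μ i * (n / 2) * P.real E1 ≤ gap μ i * (n / 2) * (p / 3) := by linarith
    exact le_of_mul_le_mul_left h2 (by positivity)
  have hP2 : P.real E2 ≤ p / 3 := by
    have h1 := mul_measureReal_le_regret B hμ (π n) hy0.le (E := E2) fun h hh => le_of_lt hh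
    have h2 : M * Real.log n ≤ y * (p / 3) := by
      rw [hy, div_mul_eq_mul_div, le_div_iff₀ (by positivity)]
      nlinarith
    exact le_of_mul_le_mul_left (h1.trans (hR.trans h2)) hy0
  have hP3 : P.real E3 ≤ p / 3 := by
    have hpm : ∀ j, Measurable fun h : History K n => (pulls j h : ℝ) := fun j =>
      (measurable_from_top (f := fun k : ℕ => (k : ℝ))).comp (measurable_pulls j)
    have hmeas : MeasurableSet E3 :=
      (measurableSet_lt (B.measurable_info i n) measurable_const).inter
        ((measurableSet_le (hpm i) measurable_const).inter
          (measurableSet_le (Finset.measurable_sum _ fun j _ => (hpm j).const_mul _)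
            measurable_const))
    have hD : ∀ h ∈ E3, B.discrepancy μ (raise μ i δ) n h ≤ (1 - a) / 2 * Real.log n := by
      intro h hh
      refine (discrepancy_raise_le B hμ i hδ hδ1 h).trans ?_
      have h1 : (gap μ i + δ) ^ 2 * B.info i n h ≤ (2 * gap μ i) ^ 2 * x :=
        mul_le_mul (pow_le_pow_left₀ (by positivity) (by linarith) 2) hh.1.le
          (B.info_nonneg i n h) (by positivity)
      have h2 : 2 * δ ^ 2 * ∑ j, gap μ j * (pulls j h : ℝ) ≤ 2 * δ ^ 2 * y :=
        mul_le_mul_of_nonneg_left hh.2.2 (by positivity)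
      have h3 : (2 * gap μ i) ^ 2 * x = (1 - a) / 4 * Real.log n := by
        rw [hx]; field_simp; ring
      have h4 : 2 * δ ^ 2 * y = (1 - a) / 4 * Real.log n := by
        rw [hy]; field_simp; ring
      linarith
    have h1 := historyLaw_real_sq_le B μ (raise μ i δ) (π n) n hmeas hD
    have h2 := measureReal_raise_le B μ i hδ (by linarith) hπ (by omega) (E := E3)
      fun h hh => hh.2.1
    have h3 : Real.exp ((1 - a) / 2 * Real.log n) = (n : ℝ) ^ ((1 - a) / 2) := by
      rw [Real.rpow_def_of_pos hn0]; ring_nf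
    have h4 : (n : ℝ) ^ ((1 - a) / 2) * (C * (n : ℝ) ^ a) = C * (n : ℝ) ^ ((1 + a) / 2) := by
      rw [mul_left_comm, ← Real.rpow_add hn0]
      congr 2; ring
    -- The factor `exp ((1 - a) / 2 * log n) = n ^ ((1 - a) / 2)` loses against the decay like
    -- `n ^ (a - 1)` of the probability under `raise μ i δ`.
    have h5 : δ * (n / 2) * P.real E3 ^ 2 ≤ δ * (n / 2) * (p / 3) ^ 2 := by
      calc δ * (n / 2) * P.real E3 ^ 2
          ≤ δ * (n / 2) * (Real.exp ((1 - a) / 2 * Real.log n) *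
              (historyLaw B (raise μ i δ) (π n) n).real E3) := by gcongr
        _ = Real.exp ((1 - a) / 2 * Real.log n) * (δ * (n / 2) *
              (historyLaw B (raise μ i δ) (π n) n).real E3) := by ring
        _ ≤ Real.exp ((1 - a) / 2 * Real.log n) * (C * (n : ℝ) ^ a) := by gcongr
        _ ≤ _ := by rw [h3, h4]; linarith
    exact le_of_sq_le_sq (le_of_mul_le_mul_left h5 (by positivity)) (by positivity)
  calc P.real {h | B.info i n h < x} ≤ P.real (E1 ∪ E2 ∪ E3) := measureReal_mono hsub
    _ ≤ P.real E1 + P.real E2 + P.real E3 :=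
      (measureReal_union_le _ _).trans (add_le_add (measureReal_union_le _ _) le_rfl)
    _ ≤ p := by linarith

/-! ### The dichotomy between light and heavy pulls -/

theorem BiasModel.heavyPulls_eq_zero (B : BiasModel K) {θ : ℝ} (hθ : 1 ≤ θ) (i : Fin K) (t : ℕ)
    (h : History K t) : B.heavyPulls θ i t h = 0 := by
  induction t with
  | zero => rfl
  | succ t ih =>
    have h1 := (B.fraction_mem i (Fin.init h : History K t)).2
    rw [BiasModel.heavyPulls, ih, if_neg fun h2 => absurd (h2.2.trans_le h1) (not_lt.2 hθ)]

theorem BiasModel.measurableSet_le_heavyPulls (B : BiasModel K) (θ : ℝ) (i : Fin K) (t : ℕ)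
    (b : ℝ) : MeasurableSet {h : History K t | b ≤ B.heavyPulls θ i t h} :=
  measurableSet_le measurable_const
    ((measurable_from_top (f := fun k : ℕ => (k : ℝ))).comp (B.measurable_heavyPulls θ i t))

/-- If at least three quarters of the events of a finite family have probability at least `3 / 4`,
then with probability at least `1 / 4` a quarter of the family occurs at once. -/
theorem measureReal_card_filter_mem_ge {Ω ι : Type*} [MeasurableSpace Ω] [DecidableEq ι]
    (P : Measure Ω) [IsProbabilityMeasure P] (E : ι → Set Ω) (hE : ∀ i, MeasurableSet (E i))
    {A A' : Finset ι} (hA : A.Nonempty) (hsub : A' ⊆ A)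
    (hcard : 3 / 4 * (A.card : ℝ) ≤ A'.card) (hP : ∀ i ∈ A', 3 / 4 ≤ P.real (E i))
    {F : Set Ω} (hF : MeasurableSet F)
    (hEF : ∀ ω ∉ F, ∑ i ∈ A, (E i).indicator (fun _ => (1 : ℝ)) ω ≤ A.card / 4) :
    1 / 4 ≤ P.real F := by
  have hA0 : (0 : ℝ) < A.card := by exact_mod_cast hA.card_pos
  have hint : ∀ S : Set Ω, MeasurableSet S → Integrable (S.indicator fun _ => (1 : ℝ)) P :=
    fun S hS => (integrable_const 1).indicator hS
  have hval : ∀ S : Set Ω, MeasurableSet S → ∫ ω, S.indicator (fun _ => (1 : ℝ)) ω ∂P = P.real S :=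
    fun S hS => by rw [integral_indicator hS]; simp
  have h1 : 3 / 4 * (3 / 4 * (A.card : ℝ)) ≤ ∑ i ∈ A, P.real (E i) := by
    calc 3 / 4 * (3 / 4 * (A.card : ℝ)) ≤ ∑ _i ∈ A', (3 / 4 : ℝ) := by
          rw [Finset.sum_const, nsmul_eq_mul]; linarith
      _ ≤ ∑ i ∈ A', P.real (E i) := Finset.sum_le_sum hP
      _ ≤ _ := Finset.sum_le_sum_of_subset_of_nonneg hsub fun _ _ _ => measureReal_nonneg
  have h2 : ∑ i ∈ A, P.real (E i) ≤ A.card / 4 + A.card * P.real F := by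
    have e1 : ∑ i ∈ A, P.real (E i) =
        ∫ ω, ∑ i ∈ A, (E i).indicator (fun _ => (1 : ℝ)) ω ∂P := by
      rw [integral_finsetSum _ fun i _ => hint _ (hE i)]
      exact Finset.sum_congr rfl fun i _ => (hval _ (hE i)).symm
    have e2 : (A.card : ℝ) / 4 + A.card * P.real F =
        ∫ ω, ((A.card : ℝ) / 4 + A.card * F.indicator (fun _ => (1 : ℝ)) ω) ∂P := by
      rw [integral_add (integrable_const _) ((hint _ hF).const_mul _), integral_const_mul,
        hval _ hF]
      simp
    rw [e1, e2]
    refine integral_mono (integrable_finsetSum _ fun i _ => hint _ (hE i))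
      ((integrable_const _).add ((hint _ hF).const_mul _)) fun ω => ?_
    by_cases hω : ω ∈ F
    · have : ∑ i ∈ A, (E i).indicator (fun _ => (1 : ℝ)) ω ≤ ∑ _i ∈ A, (1 : ℝ) :=
        Finset.sum_le_sum fun i _ => Set.indicator_le_self' (fun _ _ => zero_le_one) ω
      simp only [Finset.sum_const, nsmul_eq_mul, mul_one] at this
      simp only [hω, Set.indicator_of_mem]
      linarith
    · simpa [hω] using hEF ω hω
  have h3 : (A.card : ℝ) * (1 / 4) ≤ A.card * P.real F := by linarith
  exact le_of_mul_le_mul_left h3 hA0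

section Pulls

variable (B : BiasModel K) (μ : Fin K → ℝ) (π : Policy K) {n : ℕ} (i : Fin K) {x : ℝ}

theorem le_integral_pulls_of_info (hx : 0 ≤ x)
    (hinfo : (historyLaw B μ π n).real {h | B.info i n h < x} ≤ 1 / 8) :
    7 / 8 * x ≤ ∫ h, (pulls i h : ℝ) ∂(historyLaw B μ π n) := by
  have h1 := probReal_compl_eq_one_sub (μ := historyLaw B μ π n)
    (measurableSet_lt (B.measurable_info i n) (measurable_const (a := x)))
  have h2 := mul_measureReal_le_integral_pulls B μ π i hx (E := {h | B.info i n h < x}ᶜ)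
    fun h hh => (not_lt.1 (show ¬ B.info i n h < x from hh)).trans (B.info_le_pulls i n h)
  rw [h1] at h2
  nlinarith

/-- If the information on an arm does not come from heavy pulls, then each pull contributes at most
`f(θ)²` to it, so that many pulls are needed. -/
theorem le_integral_pulls_of_info_of_heavyPulls (hx : 0 ≤ x) {θ : ℝ} (hθ : 0 < B.fbar θ)
    (hinfo : (historyLaw B μ π n).real {h | B.info i n h < x} ≤ 1 / 8)
    (hheavy : (historyLaw B μ π n).real {h | x / 2 ≤ B.heavyPulls θ i n h} ≤ 3 / 4) :
    (B.fbar θ ^ 2)⁻¹ * x / 16 ≤ ∫ h, (pulls i h : ℝ) ∂(historyLaw B μ π n) := by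
  set P := historyLaw B μ π n
  set E1 : Set (History K n) := {h | B.info i n h < x}
  set E2 : Set (History K n) := {h | x / 2 ≤ B.heavyPulls θ i n h}
  have hm : MeasurableSet (E1 ∪ E2) :=
    (measurableSet_lt (B.measurable_info i n) measurable_const).union
      (B.measurableSet_le_heavyPulls θ i n _)
  have h1 := probReal_compl_eq_one_sub (μ := P) hm
  have h2 : P.real (E1 ∪ E2) ≤ 7 / 8 := (measureReal_union_le _ _).trans (by linarith)
  have hy : 0 ≤ (B.fbar θ ^ 2)⁻¹ * (x / 2) := by positivity
  have h3 := mul_measureReal_le_integral_pulls B μ π i hy (E := (E1 ∪ E2)ᶜ) fun h hh => by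
    simp only [Set.mem_compl_iff, Set.mem_union, not_or, E1, E2, Set.mem_ofPred_eq, not_lt,
      not_le] at hh
    have h4 := B.info_le_fbar_sq_mul_pulls_add_heavyPulls (θ := θ) i n h
    rw [inv_mul_le_iff₀ (by positivity)]
    linarith
  rw [h1] at h3
  nlinarith

end Pulls

/-- On a history in which many arms of `A` are pulled heavily, the regret is large: these arms have
gaps of at least `d`, and together they are pulled exponentially often. -/
theorem le_sum_gap_mul_pulls_of_heavyPulls (B : BiasModel K) {μ : Fin K → ℝ}
    (hμ : μ ∈ gaussianClass K) {θ b d : ℝ} (hb : 0 < b) (hd : 0 ≤ d)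
    (hT : ∑ j, B.T0 j ≤ b / 2) {n : ℕ} (h : History K n) {G : Finset (Fin K)} (hG : G.Nonempty)
    (hgap : ∀ i ∈ G, d ≤ gap μ i) (hh : ∀ i ∈ G, b ≤ B.heavyPulls θ i n h) {w : ℝ} (hw1 : 1 ≤ w)
    (hw : w ≤ Real.exp (θ * (G.card - 1))) :
    d * (b * w / 2) ≤ ∑ i, gap μ i * (pulls i h : ℝ) := by
  have h1 := B.mul_exp_le_sum_of_le_heavyPulls hb n h G hG hh
  have h2 : ∑ i ∈ G, B.T0 i ≤ ∑ j, B.T0 j :=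
    Finset.sum_le_univ_sum_of_nonneg fun j => zero_le_one.trans (B.one_le_T0 j)
  rw [Finset.sum_add_distrib] at h1
  have h3 : b * w / 2 ≤ ∑ i ∈ G, (pulls i h : ℝ) := by nlinarith
  calc d * (b * w / 2) ≤ d * ∑ i ∈ G, (pulls i h : ℝ) := by gcongr
    _ ≤ ∑ i ∈ G, gap μ i * (pulls i h : ℝ) := by
        rw [Finset.mul_sum]
        exact Finset.sum_le_sum fun i hi => mul_le_mul_of_nonneg_right (hgap i hi)
          (Nat.cast_nonneg _)
    _ ≤ _ := Finset.sum_le_univ_sum_of_nonneg fun j => mul_nonneg (hμ j).1 (Nat.cast_nonneg _)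

/-- The lower bound for a class `A` of arms with gaps within a factor `exp Q`, at a level `θ` at
which `f` is at least `exp (-Q)`, provided that the exponential growth of `|A| / 4` heavily pulled
arms compensates for these factors. -/
theorem exists_subset_le_regret (B : BiasModel K) {μ : Fin K → ℝ} (hμ : μ ∈ gaussianClass K)
    {C a : ℝ} (ha : a < 1) {A : Finset (Fin K)} (hA : A.Nonempty) (hgap : ∀ i ∈ A, 0 < gap μ i)
    {Q θ : ℝ} (hQ : 0 ≤ Q) (hcomp : ∀ i ∈ A, ∀ j ∈ A, gap μ i ≤ Real.exp Q * gap μ j)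
    (hf : Real.exp (-Q) ≤ B.fbar θ)
    (hgrow : θ < 1 → ∀ m : ℕ, (A.card : ℝ) / 4 ≤ m →
      K * Real.exp (6 * Q) ≤ Real.exp (θ * (m - 1))) :
    ∃ N : ℕ, ∀ n : ℕ, N ≤ n → ∀ π : ℕ → Policy K, IsConsistent B π C a →
      ∃ B' : Finset (Fin K), B' ⊆ A ∧ (A.card : ℝ) / 4 ≤ B'.card ∧
        1 / 512 * ((B.fbar θ ^ 2)⁻¹ * ∑ i ∈ B', (1 - a) * Real.log n / gap μ i +
          ∑ i ∈ B'ᶜ with 0 < gap μ i, (1 - a) * Real.log n / gap μ i) ≤ regret B μ (π n) n := by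
  classical
  have ha' : 0 < 1 - a := by linarith
  have hf0 : 0 < B.fbar θ := (Real.exp_pos _).trans_le hf
  obtain ⟨i₀, hi₀⟩ := hA
  have hd₀ := hgap i₀ hi₀
  set M : ℝ := (B.fbar θ ^ 2)⁻¹ * ∑ i ∈ A, (1 - a) / gap μ i +
    ∑ i ∈ Finset.univ with 0 < gap μ i, (1 - a) / gap μ i with hM
  have hM1 : 0 ≤ ∑ i ∈ A, (1 - a) / gap μ i :=
    Finset.sum_nonneg fun i hi => div_nonneg ha'.le (hgap i hi).le
  have hM2 : 0 ≤ ∑ i ∈ Finset.univ with 0 < gap μ i, (1 - a) / gap μ i :=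
    Finset.sum_nonneg fun i _ => div_nonneg ha'.le (hμ i).1
  have hM0 : 0 ≤ M := by positivity
  have hinfo : ∀ᶠ n : ℕ in Filter.atTop, ∀ i, 0 < gap μ i → ∀ π : ℕ → Policy K,
      IsConsistent B π C a → regret B μ (π n) n ≤ M * Real.log n →
      (historyLaw B μ (π n) n).real
        {h | B.info i n h < (1 - a) * Real.log n / (16 * gap μ i ^ 2)} ≤ 1 / 8 := by
    refine Filter.eventually_all.2 fun i => ?_
    by_cases hi : 0 < gap μ i
    · filter_upwards [eventually_measureReal_info_lt_le B hμ (C := C) ha hM0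
        (show (0 : ℝ) < 1 / 8 by norm_num) hi] with n hn _ using hn
    · exact Filter.Eventually.of_forall fun n h => absurd h hi
  -- `b n` bounds from below half of the information that each arm of `A` requires.
  set b : ℕ → ℝ := fun n => (1 - a) / (32 * gap μ i₀ ^ 2 * Real.exp (2 * Q)) * Real.log n with hb
  have hT : ∀ᶠ n : ℕ in Filter.atTop, ∑ j, B.T0 j ≤ b n / 2 := by
    have h1 : Filter.Tendsto (fun n : ℕ => b n / 2) Filter.atTop Filter.atTop :=
      ((Real.tendsto_log_atTop.comp tendsto_natCast_atTop_atTop).const_mul_atTop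
        (by positivity)).atTop_div_const two_pos
    exact h1.eventually_ge_atTop _
  obtain ⟨N, hN⟩ := Filter.eventually_atTop.1
    (hinfo.and (hT.and (Filter.eventually_ge_atTop 2)))
  refine ⟨N, fun n hn π hπ => ?_⟩
  obtain ⟨hinfo, hT, hn2⟩ := hN n hn
  have hL : 0 < Real.log n := Real.log_pos (by exact_mod_cast hn2)
  set R := regret B μ (π n) n with hR
  have hcardA : (A.card : ℝ) / 4 ≤ A.card := by
    linarith [(Nat.cast_nonneg _ : (0 : ℝ) ≤ A.card)]
  have hsumL : ∀ s : Finset (Fin K), ∑ i ∈ s, (1 - a) * Real.log n / gap μ i =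
      (∑ i ∈ s, (1 - a) / gap μ i) * Real.log n := fun s => by
    rw [Finset.sum_mul]
    exact Finset.sum_congr rfl fun i _ => by ring
  have hcompl : ∑ i ∈ Aᶜ with 0 < gap μ i, (1 - a) * Real.log n / gap μ i ≤
      ∑ i ∈ Finset.univ with 0 < gap μ i, (1 - a) * Real.log n / gap μ i :=
    Finset.sum_le_sum_of_subset_of_nonneg
      (Finset.filter_subset_filter _ (Finset.subset_univ _)) fun i _ _ =>
        div_nonneg (by positivity) (hμ i).1
  -- A regret above `M log n` exceeds the bound already.
  rcases lt_or_ge (M * Real.log n) R with hRM | hRM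
  · refine ⟨A, subset_rfl, hcardA, ?_⟩
    have h1 : (B.fbar θ ^ 2)⁻¹ * ∑ i ∈ A, (1 - a) * Real.log n / gap μ i +
        ∑ i ∈ Aᶜ with 0 < gap μ i, (1 - a) * Real.log n / gap μ i ≤ M * Real.log n := by
      rw [hsumL (Finset.univ.filter fun i => 0 < gap μ i)] at hcompl
      rw [hsumL A, hM, add_mul]
      linarith
    have h2 : 0 ≤ M * Real.log n := by positivity
    linarith
  have hinfo' := fun i (hi : 0 < gap μ i) => hinfo i hi π hπ hRM
  set x : Fin K → ℝ := fun i => (1 - a) * Real.log n / (16 * gap μ i ^ 2) with hx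
  have hx0 : ∀ i, 0 ≤ x i := fun i => by positivity
  set ET : Fin K → ℝ := fun i => ∫ h, (pulls i h : ℝ) ∂(historyLaw B μ (π n) n) with hET
  have hET0 : ∀ i, 0 ≤ gap μ i * ET i := fun i =>
    mul_nonneg (hμ i).1 (integral_nonneg fun _ => Nat.cast_nonneg _)
  have hlight : ∀ i, 0 < gap μ i → (1 - a) * Real.log n / gap μ i / 32 ≤ gap μ i * ET i := by
    intro i hi
    have h1 := le_integral_pulls_of_info B μ (π n) i (hx0 i) (hinfo' i hi)
    have h2 : 0 ≤ (1 - a) * Real.log n / gap μ i := by positivity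
    have h3 : gap μ i * (7 / 8 * x i) = 7 / 128 * ((1 - a) * Real.log n / gap μ i) := by
      simp only [hx]; field_simp; norm_num
    have h4 := mul_le_mul_of_nonneg_left h1 hi.le
    linarith
  set B' := A.filter fun i =>
    (historyLaw B μ (π n) n).real {h | x i / 2 ≤ B.heavyPulls θ i n h} ≤ 3 / 4 with hB'
  by_cases hcard : (A.card : ℝ) / 4 ≤ B'.card
  · refine ⟨B', Finset.filter_subset _ _, hcard, ?_⟩
    have h1 : ∀ i ∈ B', (B.fbar θ ^ 2)⁻¹ * ((1 - a) * Real.log n / gap μ i) / 256 ≤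
        gap μ i * ET i := by
      intro i hi
      obtain ⟨hiA, hi'⟩ := Finset.mem_filter.1 hi
      have hg := hgap i hiA
      have h2 := le_integral_pulls_of_info_of_heavyPulls B μ (π n) i (hx0 i) hf0
        (hinfo' i hg) hi'
      have h3 : gap μ i * ((B.fbar θ ^ 2)⁻¹ * x i / 16) =
          (B.fbar θ ^ 2)⁻¹ * ((1 - a) * Real.log n / gap μ i) / 256 := by
        simp only [hx]; field_simp; norm_num
      exact h3 ▸ mul_le_mul_of_nonneg_left h2 hg.le
    have h2 : R = ∑ i ∈ B', gap μ i * ET i + ∑ i ∈ B'ᶜ, gap μ i * ET i :=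
      (Finset.sum_add_sum_compl B' _).symm
    have h3 := Finset.sum_le_sum h1
    have h4 : ∑ i ∈ B'ᶜ with 0 < gap μ i, (1 - a) * Real.log n / gap μ i / 32 ≤
        ∑ i ∈ B'ᶜ, gap μ i * ET i :=
      (Finset.sum_le_sum fun i hi => hlight i (Finset.mem_filter.1 hi).2).trans
        (Finset.sum_le_sum_of_subset_of_nonneg (Finset.filter_subset _ _) fun i _ _ => hET0 i)
    rw [← Finset.sum_div] at h3 h4
    rw [← Finset.mul_sum] at h3
    have h5 : 0 ≤ (B.fbar θ ^ 2)⁻¹ * ∑ i ∈ B', (1 - a) * Real.log n / gap μ i :=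
      mul_nonneg (by positivity) (Finset.sum_nonneg fun i _ => div_nonneg (by positivity) (hμ i).1)
    have h6 : 0 ≤ ∑ i ∈ B'ᶜ with 0 < gap μ i, (1 - a) * Real.log n / gap μ i :=
      Finset.sum_nonneg fun i _ => div_nonneg (by positivity) (hμ i).1
    linarith
  · refine ⟨A, subset_rfl, hcardA, ?_⟩
    push Not at hcard
    -- A quarter of the arms of `A` is heavily pulled at once with probability at least `1 / 4`. The
    -- regret on this event pays for all of `A`, and `hall` pays for the remaining arms.
    have hall : (∑ i ∈ Finset.univ with 0 < gap μ i, (1 - a) * Real.log n / gap μ i) / 32 ≤ R := by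
      rw [Finset.sum_div]
      exact (Finset.sum_le_sum fun i hi => hlight i (Finset.mem_filter.1 hi).2).trans
        (Finset.sum_le_sum_of_subset_of_nonneg (Finset.filter_subset _ _) fun i _ _ => hET0 i)
    have hbpos : 0 < b n := by positivity
    have hbx : ∀ i ∈ A, b n ≤ x i / 2 := by
      intro i hi
      have hg := hgap i hi
      have h1 : gap μ i ^ 2 ≤ gap μ i₀ ^ 2 * Real.exp (2 * Q) := by
        calc gap μ i ^ 2 ≤ (Real.exp Q * gap μ i₀) ^ 2 :=
              pow_le_pow_left₀ hg.le (hcomp i hi i₀ hi₀) 2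
          _ = _ := by rw [mul_pow, ← Real.exp_nat_mul]; push_cast; ring
      have h2 : x i / 2 = (1 - a) / (32 * gap μ i ^ 2) * Real.log n := by
        simp only [hx]; field_simp; norm_num
      rw [h2]
      exact mul_le_mul_of_nonneg_right
        (div_le_div_of_nonneg_left ha'.le (by positivity) (by linarith)) hL.le
    set E : Fin K → Set (History K n) := fun i => {h | x i / 2 ≤ B.heavyPulls θ i n h} with hE
    have hEm : ∀ i, MeasurableSet (E i) := fun i => B.measurableSet_le_heavyPulls θ i n _
    have hsumm : Measurable fun h => ∑ i ∈ A, (E i).indicator (fun _ => (1 : ℝ)) h :=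
      Finset.measurable_sum _ fun i _ => measurable_const.indicator (hEm i)
    set F : Set (History K n) :=
      {h | (A.card : ℝ) / 4 < ∑ i ∈ A, (E i).indicator (fun _ => (1 : ℝ)) h} with hF
    have hPF : 1 / 4 ≤ (historyLaw B μ (π n) n).real F := by
      refine measureReal_card_filter_mem_ge _ E hEm (A' := A \ B') ⟨i₀, hi₀⟩ Finset.sdiff_subset
        ?_ (fun i hi => ?_) (measurableSet_lt measurable_const hsumm) fun h hh => not_lt.1 hh
      · have h1 := Finset.card_sdiff_add_card_eq_card (Finset.filter_subset _ _ : B' ⊆ A)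
        have h2 : ((A \ B').card : ℝ) + B'.card = A.card := by exact_mod_cast h1
        linarith
      · obtain ⟨h1, h2⟩ := Finset.mem_sdiff.1 hi
        by_contra h3
        exact h2 (Finset.mem_filter.2 ⟨h1, (not_le.1 h3).le⟩)
    have hK1 : (1 : ℝ) ≤ K := by exact_mod_cast i₀.pos
    have hw1 : 1 ≤ (K : ℝ) * Real.exp (6 * Q) :=
      one_le_mul_of_one_le_of_one_le hK1 (Real.one_le_exp (by positivity))
    set d := Real.exp (-Q) * gap μ i₀ with hd
    have hdpos : 0 < d := by positivity
    have hdA : ∀ i ∈ A, d ≤ gap μ i := fun i hi => by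
      have h1 := mul_le_mul_of_nonneg_left (hcomp i₀ hi₀ i hi) (Real.exp_nonneg (-Q))
      rwa [← mul_assoc, ← Real.exp_add, neg_add_cancel, Real.exp_zero, one_mul] at h1
    have hRF := mul_measureReal_le_regret B hμ (π n)
      (y := d * (b n * (K * Real.exp (6 * Q)) / 2)) (by positivity) (E := F) fun h hh => by
      set G := A.filter fun i => h ∈ E i with hG
      have h1 : (∑ i ∈ A, (E i).indicator (fun _ => (1 : ℝ)) h) = G.card := by
        simp [Set.indicator_apply, hG]
      have h2 : (A.card : ℝ) / 4 < G.card := h1 ▸ hh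
      have hGne : G.Nonempty := by
        rw [← Finset.card_pos, ← Nat.cast_pos (α := ℝ)]
        exact lt_of_le_of_lt (by positivity) h2
      have hGh : ∀ i ∈ G, b n ≤ B.heavyPulls θ i n h := fun i hi =>
        (hbx i (Finset.mem_filter.1 hi).1).trans (Finset.mem_filter.1 hi).2
      have hθ1 : θ < 1 := by
        by_contra hθ
        obtain ⟨i, hi⟩ := hGne
        have h3 := hGh i hi
        rw [B.heavyPulls_eq_zero (not_lt.1 hθ), Nat.cast_zero] at h3
        exact absurd h3 (not_le.2 hbpos)
      exact le_sum_gap_mul_pulls_of_heavyPulls B hμ hbpos hdpos.le hT h hGne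
        (fun i hi => hdA i (Finset.mem_filter.1 hi).1) hGh hw1 (hgrow hθ1 G.card h2.le)
    have hsumA : (B.fbar θ ^ 2)⁻¹ * ∑ i ∈ A, (1 - a) * Real.log n / gap μ i ≤
        Real.exp (2 * Q) * (K * ((1 - a) * Real.log n / d)) := by
      have h1 : (B.fbar θ ^ 2)⁻¹ ≤ Real.exp (2 * Q) := by
        have h2 := pow_le_pow_left₀ (Real.exp_nonneg _) hf 2
        rw [← Real.exp_nat_mul] at h2
        refine (inv_anti₀ (Real.exp_pos _) h2).trans (le_of_eq ?_)
        rw [← Real.exp_neg]; push_cast; ring_nf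
      refine mul_le_mul h1 ?_ (Finset.sum_nonneg fun i hi => div_nonneg (by positivity) (hμ i).1)
        (Real.exp_nonneg _)
      calc ∑ i ∈ A, (1 - a) * Real.log n / gap μ i ≤ ∑ _i ∈ A, (1 - a) * Real.log n / d :=
            Finset.sum_le_sum fun i hi => div_le_div_of_nonneg_left (by positivity) hdpos (hdA i hi)
        _ = A.card * ((1 - a) * Real.log n / d) := by rw [Finset.sum_const, nsmul_eq_mul]
        _ ≤ _ := by
          gcongr
          simpa using A.card_le_univ
    have hbal : d * (b n * (K * Real.exp (6 * Q)) / 2) =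
        Real.exp (2 * Q) * (K * ((1 - a) * Real.log n / d)) / 64 := by
      have e1 : Real.exp (6 * Q) = Real.exp (2 * Q) ^ 3 := by
        rw [← Real.exp_nat_mul]; push_cast; ring_nf
      have e2 : d ^ 2 * Real.exp (2 * Q) = gap μ i₀ ^ 2 := by
        rw [hd, mul_pow, ← Real.exp_nat_mul, mul_right_comm, ← Real.exp_add]
        push_cast
        simp
      rw [hb, ← e2, e1]
      field_simp
      norm_num
    have h1 : 0 ≤ d * (b n * (K * Real.exp (6 * Q)) / 2) := by positivity
    have h2 : d * (b n * (K * Real.exp (6 * Q)) / 2) / 4 ≤ R := by nlinarith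
    linarith

/-! ### The choice of the bias level -/

/-- At the level `β' / K` with `β' = biasLevel 64 K γ c c'`, a growth by `exp (β' / K)` for each of
`|A| / 4 ≥ γ K / 4` arms exceeds the factor `K exp (6 Q)`, where `Q = c (log K)^c'`. If
`β' / K < 1`, then `γ K` is large, and rounding plays no role. -/
theorem mul_exp_le_exp_biasLevel {K : ℕ} (hK : 1 < K) {γ c c' : ℝ} (hγ : 0 < γ)
    (hγ1 : γ ≤ 1) (hc : 0 ≤ c) (hθ : biasLevel 64 K γ c c' / K < 1) {m : ℝ} (hm : γ * K / 4 ≤ m) :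
    K * Real.exp (6 * (c * Real.log K ^ c')) ≤
      Real.exp (biasLevel 64 K γ c c' / K * (m - 1)) := by
  have hK0 : (0 : ℝ) < K := by exact_mod_cast (by omega : 0 < K)
  have hK2 : (2 : ℝ) ≤ K := by exact_mod_cast hK
  have hQ : 0 ≤ c * Real.log K ^ c' :=
    mul_nonneg hc (Real.rpow_nonneg (Real.log_nonneg (by linarith)) _)
  set Q := c * Real.log K ^ c' with hQdef
  have hlog : Real.log K ≤ Real.log (K / γ) :=
    Real.log_le_log hK0 ((le_div_iff₀ hγ).2 (by nlinarith))
  have hlog2 : 1 / 2 ≤ Real.log K := by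
    have h1 := Real.log_le_log two_pos hK2
    linarith [Real.log_two_gt_d9]
  have hθeq : biasLevel 64 K γ c c' / K = 64 * (Real.log (K / γ) + Q) / (γ * K) := by
    rw [biasLevel, ← hQdef]; field_simp
  have hγK : 0 < γ * K := by positivity
  rw [hθeq] at hθ ⊢
  rw [div_lt_one hγK] at hθ
  have hm2 : γ * K / 8 ≤ m - 1 := by linarith
  calc K * Real.exp (6 * Q) = Real.exp (Real.log K + 6 * Q) := by
        rw [Real.exp_add, Real.exp_log hK0]
    _ ≤ Real.exp (64 * (Real.log (K / γ) + Q) / (γ * K) * (γ * K / 8)) := by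
        rw [Real.exp_le_exp]
        have : 64 * (Real.log (K / γ) + Q) / (γ * K) * (γ * K / 8) =
            8 * (Real.log (K / γ) + Q) := by field_simp; ring
        linarith
    _ ≤ _ := by
        rw [Real.exp_le_exp]
        exact mul_le_mul_of_nonneg_left hm2 (div_nonneg (by linarith) hγK.le)

theorem two_div_le_biasLevel_div {K : ℕ} (hK : 1 < K) {γ c c' : ℝ} (hγ : 0 < γ)
    (hγ1 : γ ≤ 1) (hc : 0 ≤ c) : 2 / (γ * K) ≤ biasLevel 64 K γ c c' / K := by
  have hK0 : (0 : ℝ) < K := by exact_mod_cast (by omega : 0 < K)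
  have hK2 : (2 : ℝ) ≤ K := by exact_mod_cast hK
  have hQ : 0 ≤ c * Real.log K ^ c' :=
    mul_nonneg hc (Real.rpow_nonneg (Real.log_nonneg (by linarith)) _)
  have hlog : Real.log 2 ≤ Real.log (K / γ) :=
    Real.log_le_log two_pos ((le_div_iff₀ hγ).2 (by nlinarith))
  have hθeq : biasLevel 64 K γ c c' / K =
      64 * (Real.log (K / γ) + c * Real.log K ^ c') / (γ * K) := by
    rw [biasLevel]; field_simp
  rw [hθeq]
  have := Real.log_two_gt_d9
  gcongr
  linarith

/-- The bound for a class of suboptimal arms with comparable gaps. -/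
theorem lower_bound_of_comparable {K : ℕ} (hK : 1 < K) (B : BiasModel K)
    {μ : Fin K → ℝ} (hμ : μ ∈ gaussianClass K) {C a : ℝ} (ha : a < 1) {c c' : ℝ} (hc : 0 ≤ c)
    {γ : ℝ} {A : Finset (Fin K)} (hγ : 0 < γ) (hγ1 : γ < 1) (hA : ∀ i ∈ A, 0 < gap μ i)
    (hcard : γ * K ≤ A.card)
    (hcomp : ∀ i ∈ A, ∀ j ∈ A, Real.log (gap μ i / gap μ j) ≤ c * Real.log K ^ c')
    (hf : 0 < B.fbar (2 / (γ * K)))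
    (hlogf : -Real.log (B.fbar (2 / (γ * K))) ≤ c * Real.log K ^ c') :
    0 < B.fbar (biasLevel 64 K γ c c' / K) ∧
    ∃ N : ℕ, ∀ n : ℕ, N ≤ n → ∀ π : ℕ → Policy K, IsConsistent B π C a →
      ∃ B' : Finset (Fin K), B' ⊆ A ∧ (A.card : ℝ) / 4 ≤ B'.card ∧
        1 / 512 * ((B.fbar (biasLevel 64 K γ c c' / K) ^ 2)⁻¹ *
                ∑ i ∈ B' with 0 < gap μ i, γ * (1 - a) * Real.log n / gap μ i +
              ∑ i ∈ B'ᶜ with 0 < gap μ i, (1 - a) * Real.log n / gap μ i)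
          ≤ regret B μ (π n) n := by
  have hK0 : (0 : ℝ) < K := by exact_mod_cast (by omega : 0 < K)
  have hQ : 0 ≤ c * Real.log K ^ c' :=
    mul_nonneg hc (Real.rpow_nonneg (Real.log_natCast_nonneg K) _)
  have hfle := B.fbar_mono (by positivity : 0 < 2 / (γ * K))
    (two_div_le_biasLevel_div (c' := c') hK hγ hγ1.le hc)
  have hne : A.Nonempty := by
    rw [← Finset.card_pos, ← Nat.cast_pos (α := ℝ)]
    exact (mul_pos hγ hK0).trans_le hcard
  refine ⟨hf.trans_le hfle, ?_⟩
  obtain ⟨N, hN⟩ := exists_subset_le_regret B hμ (C := C) ha hne hA hQ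
    (θ := biasLevel 64 K γ c c' / K)
    (fun i hi j hj => by
      have h1 := hA i hi
      have h2 := hA j hj
      rw [← div_le_iff₀ h2]
      exact (Real.log_le_iff_le_exp (div_pos h1 h2)).1 (hcomp i hi j hj))
    (((Real.le_log_iff_exp_le hf).1 (by linarith)).trans hfle)
    fun hθ m hm => mul_exp_le_exp_biasLevel hK hγ hγ1.le hc hθ (by linarith)
  refine ⟨N, fun n hn π hπ => ?_⟩
  obtain ⟨B', hsub, hcardB, hR⟩ := hN n hn π hπ
  refine ⟨B', hsub, hcardB, le_trans ?_ hR⟩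
  have hlog : 0 ≤ Real.log n := Real.log_natCast_nonneg n
  have ha' : 0 ≤ 1 - a := by linarith
  have h1 : ∑ i ∈ B' with 0 < gap μ i, γ * (1 - a) * Real.log n / gap μ i ≤
      ∑ i ∈ B', (1 - a) * Real.log n / gap μ i := by
    rw [Finset.filter_true_of_mem fun i hi => hA i (hsub hi)]
    refine Finset.sum_le_sum fun i hi => div_le_div_of_nonneg_right ?_ (hμ i).1
    rw [mul_assoc]
    exact mul_le_of_le_one_left (mul_nonneg ha' hlog) hγ1.le
  gcongr

/-- The simplified bound: with a unique optimal arm, all other arms form one comparable class. -/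
theorem lower_bound_of_unique_optimal {K : ℕ} (hK : 1 < K) (B : BiasModel K)
    {μ : Fin K → ℝ} (hμ : μ ∈ gaussianClass K) {C a : ℝ} (ha : a < 1) {c c' : ℝ} (hc : 0 ≤ c)
    (hc' : 0 ≤ c') (huniq : ∃! i, gap μ i = 0)
    (hcomp : ∀ i j, 0 < gap μ i → 0 < gap μ j → gap μ i / gap μ j ≤ c)
    (hf : 0 < B.fbar (2 / (((K : ℝ) - 1) / K * K)))
    (hlogf : -Real.log (B.fbar (2 / (((K : ℝ) - 1) / K * K))) ≤ c * Real.log K ^ c') :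
    0 < B.fbar (biasLevel 64 K (((K : ℝ) - 1) / K) c c' / K) ∧
    ∃ N : ℕ, ∀ n : ℕ, N ≤ n → ∀ π : ℕ → Policy K, IsConsistent B π C a →
      1 / 4096 * (1 - a) / c * ((B.fbar (biasLevel 64 K (((K : ℝ) - 1) / K) c c' / K) ^ 2)⁻¹ *
          ∑ i with 0 < gap μ i, Real.log n / gap μ i)
        ≤ regret B μ (π n) n := by
  classical
  have hK0 : (0 : ℝ) < K := by exact_mod_cast (by omega : 0 < K)
  have hK2 : (2 : ℝ) ≤ K := by exact_mod_cast hK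
  obtain ⟨i₀, hi₀, huniq⟩ := huniq
  set A : Finset (Fin K) := Finset.univ.filter fun i => 0 < gap μ i with hAdef
  have hAe : A = Finset.univ.erase i₀ := by
    ext i
    simp only [hAdef, Finset.mem_filter, Finset.mem_univ, true_and, Finset.mem_erase, and_true]
    refine ⟨fun h1 h2 => ?_, fun h1 => lt_of_le_of_ne (hμ i).1 fun h2 => h1 (huniq i h2.symm)⟩
    rw [h2] at h1
    exact absurd h1 (by rw [show gap μ i₀ = 0 from hi₀]; exact lt_irrefl _)
  have hcard : (A.card : ℝ) = K - 1 := by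
    rw [hAe, Finset.card_erase_of_mem (Finset.mem_univ _), Finset.card_univ, Fintype.card_fin,
      Nat.cast_sub hK.le, Nat.cast_one]
  have hA : ∀ i ∈ A, 0 < gap μ i := fun i hi => (Finset.mem_filter.1 hi).2
  obtain ⟨k, hk⟩ : A.Nonempty := by
    rw [← Finset.card_pos, ← Nat.cast_pos (α := ℝ), hcard]
    linarith
  have hc1 : 1 ≤ c := by
    have := hcomp k k (hA k hk) (hA k hk)
    rwa [div_self (hA k hk).ne'] at this
  have hQ : 0 ≤ c * Real.log K ^ c' :=
    mul_nonneg hc (Real.rpow_nonneg (Real.log_natCast_nonneg K) _)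
  -- For `K ≥ 3` one has `log c ≤ c` and `log K ≥ 1`; for `K = 2` there is only one suboptimal arm.
  have hlogcomp : ∀ i ∈ A, ∀ j ∈ A, Real.log (gap μ i / gap μ j) ≤ c * Real.log K ^ c' := by
    intro i hi j hj
    rcases Nat.eq_or_lt_of_le hK with h2 | h3
    · have h1 : A.card ≤ 1 := by
        rw [← Nat.cast_le (α := ℝ), hcard, ← h2]; norm_num
      rw [Finset.card_le_one.1 h1 i hi j hj, div_self (hA j hj).ne', Real.log_one]
      exact hQ
    · have h4 : (3 : ℝ) ≤ K := by exact_mod_cast h3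
      have h5 : 1 ≤ Real.log K := by
        rw [Real.le_log_iff_exp_le hK0]
        linarith [Real.exp_one_lt_d9]
      have h6 := Real.one_le_rpow h5 hc'
      have h7 := Real.log_le_sub_one_of_pos (div_pos (hA i hi) (hA j hj))
      have h8 := hcomp i j (hA i hi) (hA j hj)
      nlinarith
  have hγ : 0 < ((K : ℝ) - 1) / K := div_pos (by linarith) hK0
  have hγ1 : ((K : ℝ) - 1) / K < 1 := (div_lt_one hK0).2 (by linarith)
  have hγ2 : 1 / 2 ≤ ((K : ℝ) - 1) / K := by
    rw [le_div_iff₀ hK0]; linarith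
  obtain ⟨hpos, N, hN⟩ := lower_bound_of_comparable hK B hμ (C := C) ha hc hγ hγ1 hA
    (by rw [hcard, div_mul_cancel₀ _ hK0.ne']) hlogcomp hf hlogf
  refine ⟨hpos, N, fun n hn π hπ => ?_⟩
  obtain ⟨B', hsub, hcardB, hR⟩ := hN n hn π hπ
  refine le_trans ?_ hR
  set φ := (B.fbar (biasLevel 64 K (((K : ℝ) - 1) / K) c c' / K) ^ 2)⁻¹ with hφ
  have hφ0 : 0 ≤ φ := by positivity
  have hlog : 0 ≤ Real.log n := Real.log_natCast_nonneg n
  have ha' : 0 < 1 - a := by linarith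
  have hrest : 0 ≤ ∑ i ∈ B'ᶜ with 0 < gap μ i, (1 - a) * Real.log n / gap μ i :=
    Finset.sum_nonneg fun i _ => div_nonneg (mul_nonneg ha'.le hlog) (hμ i).1
  rw [Finset.filter_true_of_mem fun i hi => hA i (hsub hi)]
  set SA := ∑ i ∈ A, Real.log n / gap μ i with hSA
  set SB := ∑ j ∈ B', Real.log n / gap μ j with hSB
  have hSB0 : 0 ≤ SB := Finset.sum_nonneg fun j _ => div_nonneg hlog (hμ j).1
  -- All terms are within a factor `c` of each other, and `B'` carries a quarter of them.
  have hSAB : SA ≤ 4 * c * SB := by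
    have hB0 : (0 : ℝ) < B'.card := by linarith
    have h1 : (B'.card : ℝ) * SA ≤ A.card * (c * SB) := by
      calc (B'.card : ℝ) * SA = ∑ i ∈ A, ∑ _j ∈ B', Real.log n / gap μ i := by
            simp only [Finset.sum_const, nsmul_eq_mul, hSA, Finset.mul_sum]
        _ ≤ ∑ _i ∈ A, ∑ j ∈ B', c * (Real.log n / gap μ j) := by
            refine Finset.sum_le_sum fun i hi => Finset.sum_le_sum fun j hj => ?_
            have hgi := hA i hi
            have hgj := hA j (hsub hj)
            have h2 := hcomp j i hgj hgi
            rw [div_le_iff₀ hgi] at h2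
            rw [← mul_div_assoc, div_le_div_iff₀ hgi hgj]
            nlinarith
        _ = _ := by simp only [Finset.sum_const, nsmul_eq_mul, hSB, Finset.mul_sum]
    have h2 : (B'.card : ℝ) * SA ≤ B'.card * (4 * c * SB) := by
      have h3 : 0 ≤ c * SB := by positivity
      nlinarith
    exact le_of_mul_le_mul_left h2 hB0
  have hsum : ∑ j ∈ B', ((K : ℝ) - 1) / K * (1 - a) * Real.log n / gap μ j =
      ((K : ℝ) - 1) / K * (1 - a) * SB := by
    rw [hSB, Finset.mul_sum]
    exact Finset.sum_congr rfl fun j _ => mul_div_assoc _ _ _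
  have hc0 : 0 < c := by linarith
  calc 1 / 4096 * (1 - a) / c * (φ * SA) ≤ 1 / 4096 * (1 - a) / c * (φ * (4 * c * SB)) := by gcongr
    _ = 1 / 512 * (φ * (1 / 2 * (1 - a) * SB)) := by field_simp; ring
    _ ≤ 1 / 512 * (φ * (((K : ℝ) - 1) / K * (1 - a) * SB)) := by
        gcongr
    _ ≤ _ := by rw [hsum]; linarith

end AffinityBandit

end

open AffinityBandit in
theorem mainTheorem1 :
    ∃ C₀ : ℝ, 0 < C₀ ∧ ∃ C₁ : ℝ, 0 < C₁ ∧
    ∀ (K : ℕ), 1 < K → ∀ (B : BiasModel K) (μ : Fin K → ℝ), μ ∈ gaussianClass K →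
    ∀ (C a : ℝ), 0 < C → 0 < a → a < 1 →
    ∀ ε : ℝ, 0 < ε → ε ≤ (1 - ⨆ i, μ i) / (⨆ i, gap μ i) →
    ∀ (c c' : ℝ), 0 ≤ c → 0 ≤ c' →
      -- the bound for a class `A` of suboptimal arms with comparable gaps
      (∀ (γ : ℝ) (A : Finset (Fin K)), 0 < γ → γ < 1 →
        (∀ i ∈ A, 0 < gap μ i) →
        γ * K ≤ A.card →
        (∀ i ∈ A, ∀ j ∈ A, Real.log (gap μ i / gap μ j) ≤ c * Real.log K ^ c') →
        0 < B.fbar (2 / (γ * K)) →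
        -Real.log (B.fbar (2 / (γ * K))) ≤ c * Real.log K ^ c' →
        0 < B.fbar (biasLevel C₁ K γ c c' / K) ∧
        ∃ N : ℕ, ∀ n : ℕ, N ≤ n → ∀ π : ℕ → Policy K, IsConsistent B π C a →
          ∃ B' : Finset (Fin K), B' ⊆ A ∧ (A.card : ℝ) / 4 ≤ B'.card ∧
            C₀ * ((B.fbar (biasLevel C₁ K γ c c' / K) ^ 2)⁻¹ *
                    ∑ i ∈ B' with 0 < gap μ i, γ * (1 - a) * Real.log n / gap μ i +
                  ∑ i ∈ B'ᶜ with 0 < gap μ i, (1 - a) * Real.log n / gap μ i)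
              ≤ regret B μ (π n) n) ∧
      -- the simplified bound: unique optimal arm, gaps within a factor `c`, `γ = (K - 1) / K`
      ((∃! i, gap μ i = 0) →
        (∀ i j, 0 < gap μ i → 0 < gap μ j → gap μ i / gap μ j ≤ c) →
        0 < B.fbar (2 / (((K : ℝ) - 1) / K * K)) →
        -Real.log (B.fbar (2 / (((K : ℝ) - 1) / K * K))) ≤ c * Real.log K ^ c' →
        0 < B.fbar (biasLevel C₁ K (((K : ℝ) - 1) / K) c c' / K) ∧
        ∃ N : ℕ, ∀ n : ℕ, N ≤ n → ∀ π : ℕ → Policy K, IsConsistent B π C a →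
          C₀ * (1 - a) / c * ((B.fbar (biasLevel C₁ K (((K : ℝ) - 1) / K) c c' / K) ^ 2)⁻¹ *
              ∑ i with 0 < gap μ i, Real.log n / gap μ i)
            ≤ regret B μ (π n) n) := by
  -- The second bound loses a factor `8` to the first: `B'` carries a quarter of the arms, and
  -- `γ ≥ 1 / 2`.
  refine ⟨1 / 4096, by norm_num, 64, by norm_num, ?_⟩
  intro K hK B μ hμ C a _ _ ha _ _ _ c c' hc hc'
  refine ⟨fun γ A hγ hγ1 hA hcard hcomp hf hlogf => ?_, fun huniq hcomp hf hlogf =>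
    lower_bound_of_unique_optimal hK B hμ ha hc hc' huniq hcomp hf hlogf⟩
  obtain ⟨hpos, N, hN⟩ := lower_bound_of_comparable hK B hμ (C := C) ha hc hγ hγ1 hA hcard hcomp
    hf hlogf
  refine ⟨hpos, N, fun n hn π hπ => ?_⟩
  obtain ⟨B', hsub, hcardB, hR⟩ := hN n hn π hπ
  refine ⟨B', hsub, hcardB, le_trans ?_ hR⟩
  have hlog : 0 ≤ Real.log n := Real.log_natCast_nonneg n
  have ha' : 0 ≤ 1 - a := by linarith
  refine mul_le_mul_of_nonneg_right (by norm_num) (add_nonneg (mul_nonneg (by positivity) ?_) ?_)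
  · exact Finset.sum_nonneg fun i _ => div_nonneg (by positivity) (hμ i).1
  · exact Finset.sum_nonneg fun i _ => div_nonneg (by positivity) (hμ i).1
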